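/- All groups are finite. Let $G$ be a finite group. A *Fitting set* of $G$ is a nonempty set $\mathcal F$ of subgroups of $G$ such that (i) if $T\trianglelefteq S\in\mathcal F$ then $T\in\mathcal F$; (ii) if $S,T\in\mathcal F$ are both normal in $ST$ then $ST\in\mathcal F$; (iii) if $S\in\mathcal F$ and $x\in G$ then $S^x\in\mathcal F$. For $H\le G$, the radical $H_{\mathcal F}$ is the product of all normal subgroups of $H$ belonging to $\mathcal F$, and for a class $\mathfrak X$ of groups $\mathcal F\circ\mathfrak X=\{H\le G: H/H_{\mathcal F}\in\mathfrak X\}$. For a prime $p$ let $\mathfrak E_{p'}$ be the class of $p'$-groups and $\mathfrak E_{p'}\mathfrak N_p$ the class of groups $X$ such that $X/O_{p'}(X)$ is a $p$-group. An *$H$-function* of $G$ is a function $h$ assigning to each prime $p$ a Fitting set $h(p)$ of $G$; put $HS(h)=\bigcap_p h(p)\circ(\mathfrak E_{p'}\mathfrak N_p)$. It is *integrated* if $h(p)\subseteq HS(h)$ for all primes $p$, and *full* if $h(p)\subseteq h(q)\circ\mathfrak E_{q'}$ for all primes $p\ne q$. The *$h$-radical* of $G$ is $G_h=\prod_p G_{h(p)}$.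 For a set $\mathcal F$ of subgroups of $G$, a subgroup $V$ is *$\mathcal F$-maximal* in $N\le G$ if $V\le N$, $V\in\mathcal F$, and $U=V$ whenever $V\le U\le N$ and $U\in\mathcal F$; $V\le G$ is an *$\mathcal F$-injector* of $G$ if $V\cap N$ is $\mathcal F$-maximal in $N$ for every subnormal subgroup $N$ of $G$. A *nilpotent injector* is an injector for the set of all nilpotent subgroups. A group $X$ with Fitting subgroup $F(X)$ is *$\mathfrak N$-constrained* if $C_X(F(X))\le F(X)$. **Theorem 1.5.** Let $h$ be a full and integrated $H$-function of a finite group $G$, and let $\mathcal H=HS(h)$ be the Hartley set it defines. If $G/G_h$ is $\mathfrak N$-constrained, then: (1) a subgroup $V$ of $G$ is an $\mathcal H$-injector of $G$ if and only if $G_h\le V$ and $V/G_h$ is a nilpotent injector of $G/G_h$; (2) $G$ possesses an $\mathcal H$-injector, and any two $\mathcal H$-injectors of $G$ are conjugate in $G$; (3) a subgroup $V$ of $G$ is an $\mathcal H$-injector of $G$ if and only if $V$ is $\mathcal H$-maximal in $G$ and $G_{\mathcal H}\le V$. -/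

import Mathlib

universe u

/-- A class of groups, as a predicate; it is only ever applied to finite groups. -/
abbrev GroupClass : Type (u + 1) := ∀ (G : Type u) [Group G], Prop

/-- The class of nilpotent groups. -/
def nilpotentClass : GroupClass.{u} := fun G _ => Group.IsNilpotent G

/-- The class of `p`-groups. -/
def pClass (p : ℕ) : GroupClass.{u} := fun G _ => IsPGroup p G

/-- The class of (finite) `p'`-groups. -/
def pPrimeClass (p : ℕ) : GroupClass.{u} := fun G _ => ¬ p ∣ Nat.card G

/-- The radical `G_𝔛` of a group for a class `𝔛`: the product of all normal `𝔛`-subgroups. -/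
def classRadical (X : GroupClass.{u}) (G : Type u) [Group G] : Subgroup G :=
  sSup {N : Subgroup G | N.Normal ∧ X N}

instance classRadical_normal (X : GroupClass.{u}) (G : Type u) [Group G] :
    (classRadical X G).Normal :=
  Subgroup.sSup_normal _ fun _ hN => hN.1

/-- The product `𝔛𝔜` of classes of groups: all `G` with `G / G_𝔛 ∈ 𝔜`. -/
def classProd (X Y : GroupClass.{u}) : GroupClass.{u} := fun G _ => Y (G ⧸ classRadical X G)

/-- The Fitting subgroup `F(G)`. -/
def fittingSubgroup (G : Type u) [Group G] : Subgroup G := classRadical nilpotentClass G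

/-- `C_G(F(G)) ≤ F(G)`. -/
def IsNConstrained (G : Type u) [Group G] : Prop :=
  Subgroup.centralizer (fittingSubgroup G : Set G) ≤ fittingSubgroup G

/-- `T` is a normal subgroup of `S`, for subgroups `T`, `S` of `G`. -/
def IsNormalIn {G : Type u} [Group G] (T S : Subgroup G) : Prop :=
  T ≤ S ∧ (T.subgroupOf S).Normal

/-- `S` and `T` are conjugate in `G`. -/
def AreConjugate {G : Type u} [Group G] (S T : Subgroup G) : Prop :=
  ∃ x : G, T = S.map (MulAut.conj x).toMonoidHom

/-- Fitting sets of `G`. If `S` and `T` are normal in their join, then the join is `ST`. -/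
structure IsFittingSet {G : Type u} [Group G] (F : Set (Subgroup G)) : Prop where
  nonempty : F.Nonempty
  normal_mem : ∀ S ∈ F, ∀ T : Subgroup G, IsNormalIn T S → T ∈ F
  sup_mem : ∀ S ∈ F, ∀ T ∈ F, IsNormalIn S (S ⊔ T) → IsNormalIn T (S ⊔ T) → S ⊔ T ∈ F
  conj_mem : ∀ S ∈ F, ∀ T : Subgroup G, AreConjugate S T → T ∈ F

/-- The radical `H_𝓕` of a subgroup `H` of `G`: the product of all normal subgroups of `H` that
belong to `𝓕`. -/
def setRadical {G : Type u} [Group G] (F : Set (Subgroup G)) (H : Subgroup G) : Subgroup G :=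
  sSup {N : Subgroup G | IsNormalIn N H ∧ N ∈ F}

theorem setRadical_le {G : Type u} [Group G] (F : Set (Subgroup G)) (H : Subgroup G) :
    setRadical F H ≤ H :=
  sSup_le fun _ hN => hN.1.1

instance setRadical_subgroupOf_normal {G : Type u} [Group G] (F : Set (Subgroup G))
    (H : Subgroup G) : ((setRadical F H).subgroupOf H).Normal := by
  rw [Subgroup.normal_subgroupOf_iff_le_normalizer (setRadical_le F H)]
  intro g hg
  have key : ∀ k ∈ H, ∀ x ∈ setRadical F H, k * x * k⁻¹ ∈ setRadical F H := by
    intro k hk x hx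
    have hle : setRadical F H ≤ (setRadical F H).comap (MulAut.conj k).toMonoidHom := by
      refine sSup_le fun N hN y hy => ?_
      have hyH := hN.1.1 hy
      have := hN.1.2.conj_mem ⟨y, hyH⟩ (by simpa [Subgroup.mem_subgroupOf] using hy) ⟨k, hk⟩
      have h2 : k * y * k⁻¹ ∈ N := by simpa [Subgroup.mem_subgroupOf] using this
      have h3 : N ≤ setRadical F H := le_sSup hN
      simpa using h3 h2
    simpa using hle hx
  rw [Subgroup.mem_normalizer_iff]
  intro x
  refine ⟨key g hg x, fun hx => ?_⟩
  have := key g⁻¹ (inv_mem hg) _ hx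
  simpa [mul_assoc] using this

/-- The radical `G_𝓕` of the whole group. -/
def groupRadical {G : Type u} [Group G] (F : Set (Subgroup G)) : Subgroup G := setRadical F ⊤

/-- The product `𝓕 ∘ 𝔛 = {H ≤ G : H / H_𝓕 ∈ 𝔛}`. -/
def setProd {G : Type u} [Group G] (F : Set (Subgroup G)) (X : GroupClass.{u}) :
    Set (Subgroup G) :=
  {H | X (H ⧸ (setRadical F H).subgroupOf H)}

/-- `H`-functions of `G`: functions from the primes to the Fitting sets of `G`. -/
def IsHFunction {G : Type u} [Group G] (h : Nat.Primes → Set (Subgroup G)) : Prop :=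
  ∀ p, IsFittingSet (h p)

/-- `HS(h) = ⋂ₚ h(p) ∘ (𝔈_{p'} 𝔑_p)`. -/
def hartleySet {G : Type u} [Group G] (h : Nat.Primes → Set (Subgroup G)) : Set (Subgroup G) :=
  ⋂ p : Nat.Primes, setProd (h p) (classProd (pPrimeClass p) (pClass p))

/-- `h` is integrated: `h(p) ⊆ HS(h)` for all `p`. -/
def IsIntegrated {G : Type u} [Group G] (h : Nat.Primes → Set (Subgroup G)) : Prop :=
  ∀ p, h p ⊆ hartleySet h

/-- `h` is full: `h(p) ⊆ h(q) ∘ 𝔈_{q'}` for all different primes `p`, `q`. -/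
def IsFull {G : Type u} [Group G] (h : Nat.Primes → Set (Subgroup G)) : Prop :=
  ∀ p q : Nat.Primes, p ≠ q → h p ⊆ setProd (h q) (pPrimeClass q)

/-- The `h`-radical `G_h`: the product of the radicals `G_{h(p)}`. -/
def hRadical {G : Type u} [Group G] (h : Nat.Primes → Set (Subgroup G)) : Subgroup G :=
  ⨆ p : Nat.Primes, groupRadical (h p)

theorem groupRadical_normal {G : Type u} [Group G] (F : Set (Subgroup G)) :
    (groupRadical F).Normal := by
  have h := setRadical_subgroupOf_normal F ⊤
  refine ⟨fun x hx g => ?_⟩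
  have := h.conj_mem ⟨x, trivial⟩
    (by simpa [Subgroup.mem_subgroupOf, groupRadical] using hx) ⟨g, trivial⟩
  simpa [Subgroup.mem_subgroupOf, groupRadical] using this

instance hRadical_normal {G : Type u} [Group G] (h : Nat.Primes → Set (Subgroup G)) :
    (hRadical h).Normal := by
  refine Subgroup.sSup_normal _ ?_
  rintro _ ⟨p, rfl⟩
  exact groupRadical_normal (h p)

/-- `V` is an `𝓕`-maximal subgroup of `N`. -/
def IsMaximalIn {G : Type u} [Group G] (F : Set (Subgroup G)) (V N : Subgroup G) : Prop :=
  V ≤ N ∧ V ∈ F ∧ ∀ U : Subgroup G, V ≤ U → U ≤ N → U ∈ F → U = V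

/-- `V` is an `𝓕`-injector of `G`: `V ∩ N` is `𝓕`-maximal in `N` for every subnormal `N`. -/
def IsInjector {G : Type u} [Group G] (F : Set (Subgroup G)) (V : Subgroup G) : Prop :=
  ∀ N : Subgroup G, N.IsSubnormal → IsMaximalIn F (V ⊓ N) N

/-- The trace of a class in `G`: the set of all subgroups of `G` that belong to the class. -/
def classTrace (X : GroupClass.{u}) (G : Type u) [Group G] : Set (Subgroup G) :=
  {H | X H}

/-- Nilpotent injectors of `G`. -/
def IsNilpotentInjector {G : Type u} [Group G] (V : Subgroup G) : Prop :=
  IsInjector (classTrace nilpotentClass G) V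

/-! Write `R` for `G_h` and `F` for `hFitting h`, the preimage of the Fitting subgroup of `G/R`.
Fullness makes `R/G_{h(p)}` a `p'`-group for every `p`, so every `V ≥ R` with `V/R` nilpotent lies
in `HS(h)`. The partial converse is `isNilpotent_map_of_hFitting_inf_le`: if `N` is subnormal, `U ∈
HS(h)` and `F ∩ N ≤ U ≤ N`, then constraint forces all radicals `U_{h(p)}` into `R`, and `U` has
nilpotent image in `G/R`. Hence `F` is the `HS(h)`-radical of `G`, and `HS(h)`-maximal subgroups
above `F` map to maximal nilpotent subgroups of `G/R` above its Fitting subgroup.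

What remains is Mann's theorem: in an `𝔑`-constrained group with Fitting subgroup `F`, the maximal
nilpotent subgroups above `F` are nilpotent injectors and are conjugate. Let `C_p` centralize the
`p'`-elements of `F`. Each of these subgroups is a join of Sylow `p`-subgroups of the `C_p`. For `p
≠ q`, `C_p ∩ C_q ≤ C(F) ≤ F`, whence `C_q` normalizes each Sylow `p`-subgroup of `C_p`. So all such
joins are nilpotent, and they can be conjugated into each other one prime at a time. They are
injectors because Sylow subgroups meet subnormal subgroups in Sylow subgroups. -/

/-- The elements of order prime to `p` are closed under multiplication. For a finite group and a
prime `p` this says that the group is `p`-nilpotent. -/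
def IsPNilpotent (p : ℕ) (X : Type*) [Group X] : Prop :=
  ∀ x y : X, ¬ p ∣ orderOf x → ¬ p ∣ orderOf y → ¬ p ∣ orderOf (x * y)

/-! ### `p`-nilpotency in terms of `p'`-elements. -/

section PNilpotent

variable {X : Type*} [Group X] {Y : Type*} [Group Y] {p : ℕ}

theorem exists_not_dvd_orderOf_pow [Finite X] (hp : p.Prime) (x : X) :
    ∃ k : ℕ, ¬ p ∣ orderOf (x ^ p ^ k) := by
  obtain ⟨e, m, hm, he⟩ := Nat.exists_eq_pow_mul_and_not_dvd (orderOf_pos x).ne' p hp.ne_one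
  refine ⟨e, fun h => hm (h.trans (orderOf_dvd_of_pow_eq_one ?_))⟩
  rw [← pow_mul, ← he, pow_orderOf_eq_one]

/-- The power `p ^ k` kills the `p`-part of `x`; the further power `m` undoes its effect on `f x`.
-/
theorem exists_lift_not_dvd_orderOf [Finite X] (hp : p.Prime) (f : X →* Y) (x : X)
    (hx : ¬ p ∣ orderOf (f x)) : ∃ j : ℕ, f (x ^ j) = f x ∧ ¬ p ∣ orderOf (x ^ j) := by
  obtain ⟨k, hk⟩ := exists_not_dvd_orderOf_pow hp x
  have hc : (p ^ k).Coprime (orderOf (f x)) :=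
    Nat.Coprime.pow_left _ ((Nat.Prime.coprime_iff_not_dvd hp).2 hx)
  obtain ⟨m, hm⟩ := exists_pow_eq_self_of_coprime hc
  refine ⟨p ^ k * m, ?_, fun h => hk (h.trans ?_)⟩
  · rw [map_pow, pow_mul, hm]
  · rw [pow_mul]
    exact orderOf_pow_dvd m

theorem not_dvd_orderOf_of_pow_eq_one {x : X} {n : ℕ} (hn : ¬ p ∣ n) (h : x ^ n = 1) :
    ¬ p ∣ orderOf x :=
  fun h' => hn (h'.trans (orderOf_dvd_of_pow_eq_one h))

theorem eq_one_of_pow_eq_one_of_not_dvd (hp : p.Prime) {x : X} {k : ℕ} (hx : ¬ p ∣ orderOf x)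
    (h : x ^ p ^ k = 1) : x = 1 := by
  rw [← orderOf_eq_one_iff]
  exact Nat.Coprime.eq_one_of_dvd
    (((Nat.Prime.coprime_iff_not_dvd hp).2 hx).symm.pow_right k) (orderOf_dvd_of_pow_eq_one h)

theorem not_dvd_orderOf_conj {x : X} (g : X) (hx : ¬ p ∣ orderOf x) :
    ¬ p ∣ orderOf (g * x * g⁻¹) := by
  refine not_dvd_orderOf_of_pow_eq_one hx ?_
  rw [conj_pow, pow_orderOf_eq_one]
  group

/-- By lifting `p'`-elements, `p`-nilpotency of a quotient is tested on `p'`-elements of the group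
above. -/
theorem isPNilpotent_of_surjective [Finite X] (hp : p.Prime) (f : X →* Y)
    (hf : Function.Surjective f)
    (h : ∀ x y : X, ¬ p ∣ orderOf x → ¬ p ∣ orderOf y → ¬ p ∣ orderOf (f (x * y))) :
    IsPNilpotent p Y := by
  intro x' y' hx hy
  obtain ⟨x, rfl⟩ := hf x'
  obtain ⟨y, rfl⟩ := hf y'
  obtain ⟨i, hi, hi'⟩ := exists_lift_not_dvd_orderOf hp f x hx
  obtain ⟨j, hj, hj'⟩ := exists_lift_not_dvd_orderOf hp f y hy
  rw [← hi, ← hj, ← map_mul]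
  exact h _ _ hi' hj'

/-- The subgroup of elements of order prime to `p` in a `p`-nilpotent group. -/
def IsPNilpotent.core (hp : p.Prime) (h : IsPNilpotent p X) : Subgroup X where
  carrier := {x | ¬ p ∣ orderOf x}
  mul_mem' {x y} hx hy := h x y hx hy
  one_mem' := by simpa using hp.ne_one
  inv_mem' {x} hx := by simpa using hx

instance IsPNilpotent.core_normal (hp : p.Prime) (h : IsPNilpotent p X) : (h.core hp).Normal :=
  ⟨fun _ hx g => not_dvd_orderOf_conj g hx⟩

theorem not_dvd_card_of_forall_orderOf [Finite X] (hp : p.Prime)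
    (h : ∀ x : X, ¬ p ∣ orderOf x) : ¬ p ∣ Nat.card X := by
  intro hd
  have := Fact.mk hp
  obtain ⟨x, hx⟩ := exists_prime_orderOf_dvd_card' p hd
  exact h x (hx ▸ dvd_rfl)

theorem IsPNilpotent.not_dvd_card_core [Finite X] (hp : p.Prime) (h : IsPNilpotent p X) :
    ¬ p ∣ Nat.card (h.core hp) :=
  not_dvd_card_of_forall_orderOf hp fun x => by
    rw [← Subgroup.orderOf_coe]
    exact x.2

theorem isPNilpotent_of_normal_complement [Finite X] (hp : p.Prime) (K : Subgroup X) [K.Normal]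
    (hK : ¬ p ∣ Nat.card K) (hq : IsPGroup p (X ⧸ K)) : IsPNilpotent p X := by
  have key : ∀ x : X, ¬ p ∣ orderOf x ↔ x ∈ K := by
    intro x
    constructor
    · intro hx
      obtain ⟨k, hk⟩ := hq (QuotientGroup.mk' K x)
      have := eq_one_of_pow_eq_one_of_not_dvd hp
        (fun h => hx (h.trans (orderOf_map_dvd (QuotientGroup.mk' K) x))) hk
      rwa [QuotientGroup.mk'_apply, QuotientGroup.eq_one_iff] at this
    · intro hx h
      exact hK (h.trans (Subgroup.orderOf_dvd_natCard K hx))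
  intro x y hx hy
  rw [key] at *
  exact mul_mem hx hy

theorem not_dvd_card_sup_of_normal [Finite X] (hp : p.Prime) {M N : Subgroup X} [M.Normal]
    (hM : ¬ p ∣ Nat.card M) (hN : ¬ p ∣ Nat.card N) : ¬ p ∣ Nat.card (M ⊔ N : Subgroup X) := by
  -- `IsPGroup` with the composite base `|M| |N|` bounds the prime divisors of `|MN|`.
  have h1 : IsPGroup (Nat.card M * Nat.card N) M := IsPGroup.card.mono (dvd_mul_right _ _)
  have h2 : IsPGroup (Nat.card M * Nat.card N) N := IsPGroup.card.mono (dvd_mul_left _ _)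
  obtain ⟨n, hn⟩ := isPGroup_iff_card_dvd_pow.1 (IsPGroup.to_sup_of_normal_left h1 h2)
  intro h
  rcases hp.dvd_mul.1 (hp.dvd_of_dvd_pow (h.trans hn)) with h | h
  exacts [hM h, hN h]

theorem not_dvd_card_sSup_of_normal [Finite X] (hp : p.Prime) (s : Set (Subgroup X))
    (hs : ∀ N ∈ s, N.Normal ∧ ¬ p ∣ Nat.card N) : ¬ p ∣ Nat.card (sSup s : Subgroup X) := by
  have hc : SupClosed {N : Subgroup X | N.Normal ∧ ¬ p ∣ Nat.card N} := by
    rintro M ⟨hM, hM'⟩ N ⟨hN, hN'⟩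
    exact ⟨Subgroup.sup_normal M N, not_dvd_card_sup_of_normal hp hM' hN'⟩
  exact (hc.sSup_mem (Set.toFinite s) ⟨inferInstance, by simpa using hp.ne_one⟩ hs).2

end PNilpotent

theorem classProd_pPrimeClass_pClass_iff {p : ℕ} (hp : p.Prime) (X : Type u) [Group X]
    [Finite X] : classProd (pPrimeClass p) (pClass p) X ↔ IsPNilpotent p X := by
  constructor
  · intro h
    exact isPNilpotent_of_normal_complement hp (classRadical (pPrimeClass p) X)
      (not_dvd_card_sSup_of_normal hp _ fun N hN => hN) h
  · rintro h x
    obtain ⟨x, rfl⟩ := QuotientGroup.mk_surjective x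
    obtain ⟨k, hk⟩ := exists_not_dvd_orderOf_pow hp x
    refine ⟨k, ?_⟩
    rw [← QuotientGroup.mk_pow, QuotientGroup.eq_one_iff]
    have hle : h.core hp ≤ classRadical (pPrimeClass p) X :=
      le_sSup ⟨inferInstance, h.not_dvd_card_core hp⟩
    exact hle hk

/-! ### Nilpotency as `p`-nilpotency for all primes, and Fitting's theorem. -/

section Nilpotent

/-- By induction through the central quotient the commutator `c` is central; then its order divides
those of both `x` and `y`. -/
theorem Group.IsNilpotent.commute_of_coprime_orderOf (X : Type*) [Group X] [Group.IsNilpotent X] :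
    ∀ x y : X, (orderOf x).Coprime (orderOf y) → Commute x y := by
  refine Group.nilpotent_center_quotient_ind X
    (P := fun X _ _ => ∀ x y : X, (orderOf x).Coprime (orderOf y) → Commute x y) ?_ ?_
  · intro X _ _ x y _
    exact Subsingleton.elim _ _
  · intro X _ _ ih x y hxy
    have h1 := ih (x : X ⧸ Subgroup.center X) (y : X ⧸ Subgroup.center X)
      (Nat.Coprime.of_dvd (orderOf_map_dvd (QuotientGroup.mk' _) x)
        (orderOf_map_dvd (QuotientGroup.mk' _) y) hxy)
    obtain ⟨c, hc⟩ : ∃ c, c = x * y * x⁻¹ * y⁻¹ := ⟨_, rfl⟩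
    have hcz : c ∈ Subgroup.center X := by
      rw [← QuotientGroup.eq_one_iff, hc]
      simp only [QuotientGroup.mk_mul, QuotientGroup.mk_inv]
      rw [h1.eq]
      group
    have hcc : ∀ g, Commute c g := fun g => (Subgroup.mem_center_iff.1 hcz g).symm
    have e1 : x * y * x⁻¹ = c * y := by rw [hc]; group
    have e2 : y * x⁻¹ * y⁻¹ = c * x⁻¹ := by
      have : y * x⁻¹ * y⁻¹ = x⁻¹ * c := by rw [hc]; group
      rw [this, (hcc _).eq]
    have o1 : c ^ orderOf y = 1 := by
      have := congrArg (· ^ orderOf y) e1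
      simp only [conj_pow, pow_orderOf_eq_one, (hcc y).mul_pow] at this
      simpa using this.symm
    have o2 : c ^ orderOf x = 1 := by
      have := congrArg (· ^ orderOf x) e2
      simp only [conj_pow, (hcc x⁻¹).mul_pow, inv_pow, pow_orderOf_eq_one] at this
      simpa using this.symm
    have : c = 1 := by
      rw [← orderOf_eq_one_iff]
      exact Nat.eq_one_of_dvd_coprimes hxy (orderOf_dvd_of_pow_eq_one o2)
        (orderOf_dvd_of_pow_eq_one o1)
    rw [this, one_mul] at e1
    exact mul_inv_eq_iff_eq_mul.1 e1

variable {X : Type*} [Group X] [Finite X]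

/-- The normal Sylow subgroup has a Schur–Zassenhaus complement `K`. In `x = k * a` the factors
commute, so a `p'`-element has `a = 1`: the `p'`-elements form `K`. -/
theorem Group.IsNilpotent.isPNilpotent [Group.IsNilpotent X] {p : ℕ} (hp : p.Prime) :
    IsPNilpotent p X := by
  have := Fact.mk hp
  obtain ⟨P⟩ : Nonempty (Sylow p X) := inferInstance
  obtain ⟨K, hK⟩ := Subgroup.exists_left_complement'_of_coprime (N := (P : Subgroup X))
    P.card_coprime_index
  have hcop : (Nat.card P).Coprime (Nat.card K) := by
    rw [← hK.index_eq_card]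
    exact P.card_coprime_index
  have hKp : ∀ k ∈ K, ¬ p ∣ orderOf k := by
    intro k hk hd
    have h1 : p ∣ (P : Subgroup X).index := by
      rw [hK.index_eq_card]
      exact hd.trans (Subgroup.orderOf_dvd_natCard K hk)
    exact P.not_dvd_index h1
  have key : ∀ x : X, ¬ p ∣ orderOf x → x ∈ K := by
    intro x hx
    obtain ⟨k, a, rfl⟩ : ∃ (k : K) (a : (P : Subgroup X)), (k : X) * a = x := by
      obtain ⟨⟨k, a⟩, h⟩ := hK.2 x
      exact ⟨k, a, h⟩
    have hc : Commute (k : X) (a : X) := by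
      apply Group.IsNilpotent.commute_of_coprime_orderOf
      exact (Nat.Coprime.of_dvd (Subgroup.orderOf_dvd_natCard _ a.2)
        (Subgroup.orderOf_dvd_natCard _ k.2) hcop).symm
    have h1 : (a : X) ^ orderOf ((k : X) * a) = 1 := by
      have h2 := pow_orderOf_eq_one ((k : X) * a)
      rw [hc.mul_pow] at h2
      have h3 : (a : X) ^ orderOf ((k : X) * a) ∈ K := by
        rw [eq_inv_of_mul_eq_one_right h2]
        exact inv_mem (pow_mem k.2 _)
      have := hK.disjoint.le_bot ⟨h3, pow_mem a.2 _⟩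
      simpa using this
    have h2 := not_dvd_orderOf_of_pow_eq_one hx h1
    obtain ⟨n, hn⟩ := P.isPGroup' a
    have h3 : (a : X) = 1 := eq_one_of_pow_eq_one_of_not_dvd hp (k := n) h2 (by exact_mod_cast hn)
    rw [h3, mul_one]
    exact k.2
  intro x y hx hy
  exact hKp _ (mul_mem (key x hx) (key y hy))

theorem exists_pow_eq_one_iff_forall_prime {p : ℕ} (hp : p.Prime) (x : X) :
    (∃ k, x ^ p ^ k = 1) ↔ ∀ q : ℕ, q.Prime → q ≠ p → ¬ q ∣ orderOf x := by
  constructor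
  · rintro ⟨k, hk⟩ q hq hqp h
    exact hqp ((Nat.prime_dvd_prime_iff_eq hq hp).1
      (hq.dvd_of_dvd_pow (h.trans (orderOf_dvd_of_pow_eq_one hk))))
  · intro h
    obtain ⟨k, hk⟩ := exists_not_dvd_orderOf_pow hp x
    refine ⟨k, orderOf_eq_one_iff.1 (Nat.eq_one_iff_not_exists_prime_dvd.2 fun q hq hd => ?_)⟩
    by_cases hqp : q = p
    · exact hk (hqp ▸ hd)
    · exact h q hq hqp (hd.trans (orderOf_pow_dvd _))

/-- Intersecting the subgroups of `q'`-elements over `q ≠ p` gives a normal `p`-subgroup containing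
every Sylow `p`-subgroup. -/
theorem Group.isNilpotent_of_forall_isPNilpotent
    (h : ∀ p : ℕ, p.Prime → IsPNilpotent p X) : Group.IsNilpotent X := by
  refine (Group.isNilpotent_of_finite_tfae (G := X)).out 3 0 |>.1 fun p hp P => ?_
  let L : Subgroup X :=
    { carrier := {x | ∀ q : ℕ, q.Prime → q ≠ p → ¬ q ∣ orderOf x}
      mul_mem' := fun hx hy q hq hqp => h q hq _ _ (hx q hq hqp) (hy q hq hqp)
      one_mem' := fun q hq _ => by simpa using hq.ne_one
      inv_mem' := fun hx q hq hqp => by simpa using hx q hq hqp }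
  have hL : L.Normal := ⟨fun x hx g q hq hqp => not_dvd_orderOf_conj g (hx q hq hqp)⟩
  have hLp : IsPGroup p L := by
    rintro ⟨x, hx⟩
    obtain ⟨k, hk⟩ := (exists_pow_eq_one_iff_forall_prime hp.out x).2 hx
    exact ⟨k, Subtype.ext hk⟩
  have hPL : (P : Subgroup X) ≤ L := by
    intro x hx
    obtain ⟨k, hk⟩ := P.isPGroup' ⟨x, hx⟩
    exact (exists_pow_eq_one_iff_forall_prime hp.out x).1 ⟨k, congrArg Subtype.val hk⟩
  rw [← P.is_maximal' hLp hPL]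
  exact hL

/-- **Fitting's theorem** for finite groups. -/
theorem Group.isNilpotent_of_sup_eq_top {M N : Subgroup X} [hM : M.Normal] [hN : N.Normal]
    [hM' : Group.IsNilpotent M] [hN' : Group.IsNilpotent N] (h : M ⊔ N = ⊤) :
    Group.IsNilpotent X := by
  refine Group.isNilpotent_of_forall_isPNilpotent fun p hp => ?_
  -- The `p'`-elements of `M` form a subgroup `K` normal in `X`. Modulo both such subgroups, `X` is
  -- a product of two normal `p`-groups.
  have aux : ∀ M : Subgroup X, M.Normal → Group.IsNilpotent M →
      ∃ K : Subgroup X, K.Normal ∧ ¬ p ∣ Nat.card K ∧ ∀ x ∈ M, ∃ k : ℕ, x ^ p ^ k ∈ K := by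
    intro M hM hM'
    refine ⟨((Group.IsNilpotent.isPNilpotent hp (X := M)).core hp).map M.subtype, ⟨?_⟩, ?_, ?_⟩
    · rintro _ ⟨x, hx, rfl⟩ g
      refine ⟨⟨g * x * g⁻¹, hM.conj_mem x x.2 g⟩, ?_, rfl⟩
      have hx' : ¬ p ∣ orderOf x := hx
      change ¬ p ∣ orderOf _
      rw [← Subgroup.orderOf_coe] at hx' ⊢
      exact not_dvd_orderOf_conj g hx'
    · rw [Subgroup.card_map_of_injective M.subtype_injective]
      exact IsPNilpotent.not_dvd_card_core _ _
    · intro x hx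
      obtain ⟨k, hk⟩ := exists_not_dvd_orderOf_pow hp (⟨x, hx⟩ : M)
      exact ⟨k, _, hk, rfl⟩
  obtain ⟨K, hK, hKc, hKp⟩ := aux M hM hM'
  obtain ⟨L, hL, hLc, hLp⟩ := aux N hN hN'
  refine isPNilpotent_of_normal_complement hp (K ⊔ L) (not_dvd_card_sup_of_normal hp hKc hLc) ?_
  let π := QuotientGroup.mk' (K ⊔ L)
  have h1 : IsPGroup p (M.map π) := by
    rintro ⟨_, x, hx, rfl⟩
    obtain ⟨k, hk⟩ := hKp x hx
    refine ⟨k, Subtype.ext ?_⟩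
    exact (QuotientGroup.eq_one_iff (x ^ p ^ k)).2 ((le_sup_left : K ≤ K ⊔ L) hk)
  have h2 : IsPGroup p (N.map π) := by
    rintro ⟨_, x, hx, rfl⟩
    obtain ⟨k, hk⟩ := hLp x hx
    refine ⟨k, Subtype.ext ?_⟩
    exact (QuotientGroup.eq_one_iff (x ^ p ^ k)).2 ((le_sup_right : L ≤ K ⊔ L) hk)
  have : (M.map π).Normal := hM.map π (QuotientGroup.mk'_surjective _)
  have h3 := h1.to_sup_of_normal_left h2
  rw [← Subgroup.map_sup, h,
    Subgroup.map_top_of_surjective _ (QuotientGroup.mk'_surjective _)] at h3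
  exact h3.of_equiv Subgroup.topEquiv

end Nilpotent

/-! ### Radicals of Fitting sets, and constraint in subnormal subgroups. -/

section FittingSets

variable {G : Type u} [Group G]

theorem isNormalIn_iff {T S : Subgroup G} :
    IsNormalIn T S ↔ T ≤ S ∧ ∀ t ∈ T, ∀ s ∈ S, s * t * s⁻¹ ∈ T := by
  refine and_congr_right fun h => ?_
  rw [Subgroup.normal_subgroupOf_iff h]
  exact ⟨fun H t ht s hs => H t s ht hs, fun H t s ht hs => H t ht s hs⟩

theorem IsNormalIn.mono {T S S' : Subgroup G} (h : IsNormalIn T S) (h1 : T ≤ S') (h2 : S' ≤ S) :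
    IsNormalIn T S' := by
  rw [isNormalIn_iff] at *
  exact ⟨h1, fun t ht s hs => h.2 t ht s (h2 hs)⟩

theorem IsNormalIn.inf_right {T S : Subgroup G} (h : IsNormalIn T S) (U : Subgroup G) :
    IsNormalIn (T ⊓ U) (S ⊓ U) := by
  rw [isNormalIn_iff] at *
  refine ⟨inf_le_inf_right _ h.1, fun t ht s hs => ⟨h.2 t ht.1 s hs.1, ?_⟩⟩
  exact U.mul_mem (U.mul_mem hs.2 ht.2) (U.inv_mem hs.2)

theorem Subgroup.Normal.isNormalIn {T S : Subgroup G} (h : T.Normal) (hTS : T ≤ S) :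
    IsNormalIn T S :=
  isNormalIn_iff.2 ⟨hTS, fun t ht s _ => h.conj_mem t ht s⟩

theorem IsNormalIn.isSubnormal {T S : Subgroup G} (h : IsNormalIn T S) (hS : S.IsSubnormal) :
    T.IsSubnormal :=
  .step T S h.1 hS h.2

theorem setRadical_isNormalIn (F : Set (Subgroup G)) (H : Subgroup G) :
    IsNormalIn (setRadical F H) H :=
  ⟨setRadical_le F H, inferInstance⟩

theorem IsNormalIn.le_setRadical {F : Set (Subgroup G)} {T H : Subgroup G} (h : IsNormalIn T H)
    (hT : T ∈ F) : T ≤ setRadical F H :=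
  le_sSup ⟨h, hT⟩

namespace IsFittingSet

variable {F : Set (Subgroup G)} (hF : IsFittingSet F)

include hF

theorem bot_mem : ⊥ ∈ F := by
  obtain ⟨S, hS⟩ := hF.nonempty
  exact hF.normal_mem S hS ⊥ (Subgroup.normal_bot.isNormalIn bot_le)

theorem supClosed_normal (H : Subgroup G) :
    SupClosed {N : Subgroup G | IsNormalIn N H ∧ N ∈ F} := by
  rintro M ⟨hM, hM'⟩ N ⟨hN, hN'⟩
  refine ⟨⟨sup_le hM.1 hN.1, ?_⟩, hF.sup_mem M hM' N hN' (hM.mono le_sup_left (sup_le hM.1 hN.1))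
    (hN.mono le_sup_right (sup_le hM.1 hN.1))⟩
  rw [Subgroup.subgroupOf_sup hM.1 hN.1]
  have := hM.2
  have := hN.2
  exact Subgroup.sup_normal _ _

theorem setRadical_mem [Finite G] (H : Subgroup G) : setRadical F H ∈ F :=
  ((hF.supClosed_normal H).sSup_mem (Set.toFinite {N : Subgroup G | IsNormalIn N H ∧ N ∈ F})
    ⟨Subgroup.normal_bot.isNormalIn bot_le, hF.bot_mem⟩ le_rfl).2

/-- Conjugation by `s ∈ H` permutes the normal `F`-subgroups of `N`. -/
theorem setRadical_isNormalIn_of_isNormalIn {N H : Subgroup G} (h : IsNormalIn N H) :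
    IsNormalIn (setRadical F N) H := by
  refine isNormalIn_iff.2 ⟨(setRadical_le F N).trans h.1, fun x hx s hs => ?_⟩
  have hle : setRadical F N ≤ (setRadical F N).comap (MulAut.conj s).toMonoidHom := by
    refine sSup_le fun M hM => ?_
    rw [← Subgroup.map_le_iff_le_comap]
    refine IsNormalIn.le_setRadical ?_ (hF.conj_mem M hM.2 _ ⟨s, rfl⟩)
    rw [isNormalIn_iff] at h
    have hM' := isNormalIn_iff.1 hM.1
    refine isNormalIn_iff.2 ⟨?_, ?_⟩
    · rintro _ ⟨y, hy, rfl⟩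
      exact h.2 y (hM'.1 hy) s hs
    · rintro _ ⟨y, hy, rfl⟩ t ht
      refine ⟨s⁻¹ * t * s * y * (s⁻¹ * t * s)⁻¹, hM'.2 y hy _ ?_, ?_⟩
      · simpa using h.2 t ht s⁻¹ (inv_mem hs)
      · simp [mul_assoc]
  simpa using hle hx

theorem setRadical_mono_of_isNormalIn [Finite G] {N H : Subgroup G} (h : IsNormalIn N H) :
    setRadical F N ≤ setRadical F H :=
  (hF.setRadical_isNormalIn_of_isNormalIn h).le_setRadical (hF.setRadical_mem N)

theorem inf_setRadical_le [Finite G] {N H : Subgroup G} (h : IsNormalIn N H) :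
    N ⊓ setRadical F H ≤ setRadical F N := by
  have h1 := h.inf_right (setRadical F H)
  rw [inf_eq_right.2 (setRadical_le F H)] at h1
  have h2 := (setRadical_isNormalIn F H).inf_right N
  rw [inf_eq_right.2 h.1, inf_comm] at h2
  exact h2.le_setRadical (hF.normal_mem _ (hF.setRadical_mem H) _ h1)

theorem setRadical_le_groupRadical [Finite G] {N : Subgroup G} (hN : N.IsSubnormal) :
    setRadical F N ≤ groupRadical F := by
  induction hN with
  | top => exact le_rfl
  | step N K hle _ hn ih => exact (hF.setRadical_mono_of_isNormalIn ⟨hle, hn⟩).trans ih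

theorem le_groupRadical_of_isSubnormal [Finite G] {N : Subgroup G} (hN : N.IsSubnormal)
    (hNF : N ∈ F) : N ≤ groupRadical F :=
  (IsNormalIn.le_setRadical (isNormalIn_iff.2 ⟨le_rfl, fun _ ht _ hs =>
    mul_mem (mul_mem hs ht) (inv_mem hs)⟩) hNF).trans (hF.setRadical_le_groupRadical hN)

end IsFittingSet

theorem Subgroup.isNilpotent_of_le {T S : Subgroup G} (hS : Group.IsNilpotent S) (h : T ≤ S) :
    Group.IsNilpotent T :=
  Group.nilpotent_of_mulEquiv (Subgroup.subgroupOfEquivOfLe h)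

theorem Subgroup.isNilpotent_map {G' : Type*} [Group G'] {S : Subgroup G}
    (hS : Group.IsNilpotent S) (f : G →* G') : Group.IsNilpotent (S.map f) :=
  Group.nilpotent_of_surjective (f.subgroupMap S) (f.subgroupMap_surjective S)

theorem isFittingSet_nilpotent (G : Type u) [Group G] [Finite G] :
    IsFittingSet (classTrace nilpotentClass G) where
  nonempty := ⟨⊥, (inferInstance : Group.IsNilpotent (⊥ : Subgroup G))⟩
  normal_mem _ hS _ hT := Subgroup.isNilpotent_of_le hS hT.1
  sup_mem S hS T hT hS' hT' := by
    have := hS'.2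
    have := hT'.2
    have : Group.IsNilpotent S := hS
    have : Group.IsNilpotent T := hT
    have : Group.IsNilpotent (S.subgroupOf (S ⊔ T)) :=
      Group.nilpotent_of_mulEquiv (Subgroup.subgroupOfEquivOfLe le_sup_left).symm
    have : Group.IsNilpotent (T.subgroupOf (S ⊔ T)) :=
      Group.nilpotent_of_mulEquiv (Subgroup.subgroupOfEquivOfLe le_sup_right).symm
    refine Group.isNilpotent_of_sup_eq_top (M := S.subgroupOf (S ⊔ T))
      (N := T.subgroupOf (S ⊔ T)) ?_
    rw [← Subgroup.subgroupOf_sup le_sup_left le_sup_right, Subgroup.subgroupOf_self]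
  conj_mem S hS T := by
    rintro ⟨x, rfl⟩
    exact Subgroup.isNilpotent_map hS _

theorem isNormalIn_top_iff {N : Subgroup G} : IsNormalIn N ⊤ ↔ N.Normal :=
  ⟨fun h => ⟨fun x hx g => (isNormalIn_iff.1 h).2 x hx g trivial⟩, fun h => h.isNormalIn le_top⟩

theorem fittingSubgroup_eq_groupRadical (G : Type u) [Group G] :
    fittingSubgroup G = groupRadical (classTrace nilpotentClass G) := by
  simp only [fittingSubgroup, classRadical, groupRadical, setRadical, isNormalIn_top_iff]
  rfl

instance fittingSubgroup_normal (G : Type u) [Group G] : (fittingSubgroup G).Normal :=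
  classRadical_normal _ _

variable [Finite G]

theorem isNilpotent_fittingSubgroup (G : Type u) [Group G] [Finite G] :
    Group.IsNilpotent (fittingSubgroup G) := by
  rw [fittingSubgroup_eq_groupRadical]
  exact (isFittingSet_nilpotent G).setRadical_mem ⊤

theorem le_fittingSubgroup_of_isSubnormal {N : Subgroup G} (hN : N.IsSubnormal)
    (hNn : Group.IsNilpotent N) : N ≤ fittingSubgroup G := by
  rw [fittingSubgroup_eq_groupRadical]
  exact (isFittingSet_nilpotent G).le_groupRadical_of_isSubnormal hN hNn

/-- Subnormal subgroups of an `𝔑`-constrained group are `𝔑`-constrained. -/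
theorem IsNConstrained.centralizer_inf_le (hG : IsNConstrained G) {N : Subgroup G}
    (hN : N.IsSubnormal) :
    Subgroup.centralizer (fittingSubgroup G ⊓ N : Subgroup G) ⊓ N ≤ fittingSubgroup G := by
  induction hN with
  | top => simpa [IsNConstrained] using hG
  | step N K hle hK hn ih =>
    have hNK : IsNormalIn N K := ⟨hle, hn⟩
    have hNK' := (isNormalIn_iff.1 hNK).2
    set F := fittingSubgroup G with hF
    have hFn : F.Normal := fittingSubgroup_normal G
    set C := Subgroup.centralizer (F ⊓ N : Subgroup G) ⊓ N with hC
    have hCF : ∀ c ∈ C, ∀ y ∈ F ⊓ N, y * c = c * y := fun c hc y hy => hc.1 y hy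
    have h1 : ⁅C, F ⊓ K⁆ ≤ F ⊓ N := by
      refine Subgroup.commutator_le.2 fun c hc y hy => ⟨?_, ?_⟩
      · exact F.mul_mem (hFn.conj_mem y hy.1 c) (F.inv_mem hy.1)
      · have := N.mul_mem hc.2 (hNK' c⁻¹ (N.inv_mem hc.2) y hy.2)
        simpa [commutatorElement_def, mul_assoc] using this
    have h2 : ∀ D ≤ F ⊓ N, ⁅D, C⁆ = ⊥ := fun D hD =>
      Subgroup.commutator_eq_bot_iff_le_centralizer.2 fun y hy c hc => (hCF c hc y (hD hy)).symm
    -- By the three subgroups lemma `⁅C, C⁆` centralizes `F ⊓ K`, so induction puts it in `F ⊓ N`,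
    -- which `C` centralizes. Thus `C` is nilpotent of class at most 2 and normal in `N`.
    have h3 : ⁅⁅C, C⁆, F ⊓ K⁆ = ⊥ := by
      refine Subgroup.commutator_commutator_eq_bot_of_rotate (h2 _ h1) (h2 _ ?_)
      rw [Subgroup.commutator_comm]
      exact h1
    have hCN : ⁅C, C⁆ ≤ N := Subgroup.commutator_le.2 fun a ha b hb =>
      N.mul_mem (N.mul_mem (N.mul_mem ha.2 hb.2) (N.inv_mem ha.2)) (N.inv_mem hb.2)
    have h4 : ⁅C, C⁆ ≤ F ⊓ N := by
      refine le_inf ((le_inf ?_ (hCN.trans hle)).trans ih) hCN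
      exact Subgroup.commutator_eq_bot_iff_le_centralizer.1 h3
    have h5 : Group.IsNilpotent C :=
      Subgroup.isNilpotent_of_lowerCentralSeries_eq_bot (n := 2) (h2 _ h4)
    have h6 : IsNormalIn C N := by
      refine isNormalIn_iff.2 ⟨inf_le_right, fun c hc s hs => ⟨fun y hy => ?_, ?_⟩⟩
      · have := hCF c hc (s⁻¹ * y * s) ⟨by simpa using hFn.conj_mem y hy.1 s⁻¹,
          N.mul_mem (N.mul_mem (N.inv_mem hs) hy.2) hs⟩
        calc y * (s * c * s⁻¹) = s * (s⁻¹ * y * s * c) * s⁻¹ := by group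
          _ = s * c * s⁻¹ * y := by rw [this]; group
      · exact N.mul_mem (N.mul_mem hs hc.2) (N.inv_mem hs)
    exact le_fittingSubgroup_of_isSubnormal (h6.isSubnormal (hNK.isSubnormal hK)) h5

end FittingSets

/-! ### Sylow subgroups of subgroups and their subnormal intersections. -/

section SylowIn

variable {G : Type*} [Group G] {p : ℕ}

/-- `P` is a Sylow `p`-subgroup of the subgroup `H` of `G`. -/
structure IsSylowIn (p : ℕ) (P H : Subgroup G) : Prop where
  le : P ≤ H
  isPGroup : IsPGroup p P
  not_dvd_relIndex : ¬ p ∣ P.relIndex H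

theorem IsPGroup.exists_isSylowIn_le [Finite G] (hp : p.Prime) {Q H : Subgroup G}
    (hQ : IsPGroup p Q) (hQH : Q ≤ H) : ∃ P, IsSylowIn p P H ∧ Q ≤ P := by
  have := Fact.mk hp
  obtain ⟨S, hS⟩ := (hQ.of_equiv (Subgroup.subgroupOfEquivOfLe hQH).symm).exists_le_sylow
  refine ⟨(S : Subgroup H).map H.subtype, ⟨Subgroup.map_subtype_le _, S.isPGroup'.map _, ?_⟩, ?_⟩
  · rw [Subgroup.relIndex, Subgroup.subgroupOf,
      Subgroup.comap_map_eq_self_of_injective H.subtype_injective]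
    exact S.not_dvd_index
  · intro x hx
    exact ⟨⟨x, hQH hx⟩, hS hx, rfl⟩

theorem IsSylowIn.exists_conj [Finite G] (hp : p.Prime) {P Q H : Subgroup G}
    (hP : IsSylowIn p P H) (hQ : IsSylowIn p Q H) :
    ∃ g ∈ H, Q = P.map (MulAut.conj g).toMonoidHom := by
  have := Fact.mk hp
  let S : Sylow p H :=
    (hP.isPGroup.of_equiv (Subgroup.subgroupOfEquivOfLe hP.le).symm).toSylow hP.not_dvd_relIndex
  let T : Sylow p H :=
    (hQ.isPGroup.of_equiv (Subgroup.subgroupOfEquivOfLe hQ.le).symm).toSylow hQ.not_dvd_relIndex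
  obtain ⟨g, hg⟩ := MulAction.exists_smul_eq H S T
  refine ⟨g, g.2, ?_⟩
  have hmem : ∀ x : H, x ∈ T ↔ g⁻¹ * x * g ∈ S := by
    intro x
    rw [← hg, ← SetLike.mem_coe, Sylow.coe_smul, Set.mem_smul_set_iff_inv_smul_mem]
    simp [MulAut.smul_def, ← map_inv]
  ext x
  constructor
  · intro hx
    refine ⟨g⁻¹ * x * g, ?_, by simp [mul_assoc]⟩
    exact (hmem ⟨x, hQ.le hx⟩).1 hx
  · rintro ⟨y, hy, rfl⟩
    have h1 : (g : G) * y * (g : G)⁻¹ ∈ H := mul_mem (mul_mem g.2 (hP.le hy)) (inv_mem g.2)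
    refine (hmem ⟨_, h1⟩).2 ?_
    change (g : G)⁻¹ * (g * y * (g : G)⁻¹) * g ∈ P
    simpa [mul_assoc] using hy

theorem IsSylowIn.map_conj {P H : Subgroup G} (hP : IsSylowIn p P H) (hH : H.Normal)
    (g : G) : IsSylowIn p (P.map (MulAut.conj g).toMonoidHom) H := by
  have hHg : H.map (MulAut.conj g).toMonoidHom = H :=
    Subgroup.Normal.map_conj_eq H g
  refine ⟨?_, hP.isPGroup.map _, ?_⟩
  · rw [← hHg]
    exact Subgroup.map_mono hP.le
  · have h := Subgroup.relIndex_map_map_of_injective (f := (MulAut.conj g).toMonoidHom) P H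
      (MulAut.conj g).injective
    rw [hHg] at h
    rw [h]
    exact hP.not_dvd_relIndex

/-- `|B : P ∩ B| = |PB : P|`; this is why a Sylow subgroup meets a normal subgroup in a Sylow
subgroup. -/
theorem Subgroup.relIndex_dvd_index_of_normal_right [Finite G] (P B : Subgroup G) [B.Normal] :
    P.relIndex B ∣ P.index := by
  have h : P.relIndex B = P.relIndex (P ⊔ B) := by
    have h1 := Subgroup.relIndex_mul_relIndex ⊥ (P ⊓ B) B bot_le inf_le_right
    have h2 := Subgroup.relIndex_mul_relIndex ⊥ (P ⊓ B) P bot_le inf_le_left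
    have h3 := Subgroup.relIndex_mul_relIndex ⊥ B (P ⊔ B) bot_le le_sup_right
    have h4 := Subgroup.relIndex_mul_relIndex ⊥ P (P ⊔ B) bot_le le_sup_left
    rw [Subgroup.inf_relIndex_right] at h1
    rw [Subgroup.inf_relIndex_left] at h2
    rw [Subgroup.relIndex_sup_right] at h3
    have hP : (⊥ : Subgroup G).relIndex P ≠ 0 := by
      simpa using Nat.card_pos.ne'
    refine Nat.eq_of_mul_eq_mul_left (Nat.pos_of_ne_zero hP) ?_
    rw [h4, ← h3, ← h1, ← h2]
    ring
  rw [h]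
  exact Subgroup.relIndex_dvd_index_of_le le_sup_left

theorem IsSylowIn.not_dvd_relIndex_inf [Finite G] {P H N : Subgroup G}
    (hP : IsSylowIn p P H) (hN : N.IsSubnormal) : ¬ p ∣ P.relIndex (H ⊓ N) := by
  induction hN with
  | top => simpa using hP.not_dvd_relIndex
  | step N K hle _ hn ih =>
    intro h
    refine ih (h.trans ?_)
    have hle' : H ⊓ N ≤ H ⊓ K := inf_le_inf_left _ hle
    have hn' : ((H ⊓ N).subgroupOf (H ⊓ K)).Normal := by
      rw [Subgroup.normal_subgroupOf_iff hle'] at *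
      rw [Subgroup.normal_subgroupOf_iff hle] at hn
      exact fun x k hx hk => ⟨H.mul_mem (H.mul_mem hk.1 hx.1) (H.inv_mem hk.1),
        hn x k hx.2 hk.2⟩
    have := Subgroup.relIndex_dvd_index_of_normal_right (P.subgroupOf (H ⊓ K))
      ((H ⊓ N).subgroupOf (H ⊓ K))
    rwa [Subgroup.relIndex_subgroupOf hle'] at this

/-- `P ⊓ N` is Sylow in `H ⊓ N`, so the `p`-subgroup `S` cannot properly contain it. -/
theorem IsSylowIn.le_of_isPGroup [Finite G] (hp : p.Prime) {P H N S : Subgroup G}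
    (hP : IsSylowIn p P H) (hN : N.IsSubnormal) (hS : IsPGroup p S) (hSH : S ≤ H ⊓ N)
    (hPS : P ⊓ N ≤ S) : S ≤ P := by
  have := Fact.mk hp
  have h1 : (P ⊓ N).relIndex (H ⊓ N) = P.relIndex (H ⊓ N) := by
    rw [← Subgroup.inf_relIndex_right, ← Subgroup.inf_relIndex_right P]
    congr 1
    rw [inf_assoc, inf_eq_right.2 (inf_le_right : H ⊓ N ≤ N)]
  have h2 := Subgroup.relIndex_mul_relIndex _ _ _ hPS hSH
  obtain ⟨n, hn⟩ := hS.index ((P ⊓ N).subgroupOf S)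
  have h3 : (P ⊓ N).relIndex S = p ^ n := hn
  rcases n with _ | n
  · rw [pow_zero, Subgroup.relIndex_eq_one] at h3
    exact h3.trans inf_le_left
  · refine absurd ?_ (hP.not_dvd_relIndex_inf hN)
    rw [← h1, ← h2, h3]
    exact (dvd_pow_self p n.succ_ne_zero).mul_right _

/-- A finite group is generated by its elements of prime power order. -/
theorem Subgroup.le_of_forall_prime_pow_mem [Finite G] {U K : Subgroup G}
    (h : ∀ p : ℕ, p.Prime → ∀ x ∈ U, ∀ k : ℕ, x ^ p ^ k = 1 → x ∈ K) : U ≤ K := by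
  rw [← Subgroup.relIndex_eq_one, Nat.eq_one_iff_not_exists_prime_dvd]
  intro p hp hd
  have := Fact.mk hp
  obtain ⟨S⟩ : Nonempty (Sylow p U) := inferInstance
  refine S.not_dvd_index (hd.trans (Subgroup.index_dvd_of_le ?_))
  intro x hx
  obtain ⟨k, hk⟩ := S.isPGroup' ⟨x, hx⟩
  exact h p hp x x.2 k (by simpa using congrArg (fun y : S => ((y : U) : G)) hk)

theorem exists_mul_eq_prime_part [Finite G] (hp : p.Prime) {F : Subgroup G} {x : G} (hx : x ∈ F) :
    ∃ a ∈ F, ∃ b ∈ F, x = a * b ∧ (∃ k : ℕ, a ^ p ^ k = 1) ∧ ¬ p ∣ orderOf b := by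
  obtain ⟨e, m, hm, he⟩ := Nat.exists_eq_pow_mul_and_not_dvd (orderOf_pos x).ne' p hp.ne_one
  have hc : IsCoprime ((p ^ e : ℕ) : ℤ) (m : ℤ) :=
    Nat.isCoprime_iff_coprime.2 (Nat.Coprime.pow_left _ ((Nat.Prime.coprime_iff_not_dvd hp).2 hm))
  obtain ⟨u, v, huv⟩ := hc
  have h1 : x ^ ((p ^ e : ℕ) * (m : ℕ) : ℤ) = 1 := by
    rw [← Nat.cast_mul, ← he, zpow_natCast, pow_orderOf_eq_one]
  refine ⟨x ^ (v * m), zpow_mem hx _, x ^ (u * (p ^ e : ℕ)), zpow_mem hx _, ?_, ⟨e, ?_⟩, ?_⟩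
  · rw [← zpow_add, add_comm, huv, zpow_one]
  · rw [← zpow_natCast, ← zpow_mul, show v * m * ((p ^ e : ℕ) : ℤ) = ((p ^ e : ℕ) * (m : ℕ)) * v by
      ring, zpow_mul, h1, one_zpow]
  · refine not_dvd_orderOf_of_pow_eq_one hm ?_
    rw [← zpow_natCast, ← zpow_mul, show u * ((p ^ e : ℕ) : ℤ) * (m : ℕ) =
      ((p ^ e : ℕ) * (m : ℕ)) * u by ring, zpow_mul, h1, one_zpow]

end SylowIn

/-! ### Primary parts of nilpotent subgroups and coprime action. -/

section NilpotentSubgroups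

variable {G : Type*} [Group G] {p : ℕ}

theorem Group.IsNilpotent.commute_of_mem {U : Subgroup G} (hU : Group.IsNilpotent U)
    (hp : p.Prime) {x y : G} (hx : x ∈ U) (hy : y ∈ U) {k : ℕ} (hxk : x ^ p ^ k = 1)
    (hyp : ¬ p ∣ orderOf y) : Commute x y := by
  have h := Group.IsNilpotent.commute_of_coprime_orderOf U ⟨x, hx⟩ ⟨y, hy⟩ (by
    rw [Subgroup.orderOf_mk, Subgroup.orderOf_mk]
    exact Nat.Coprime.coprime_dvd_left (orderOf_dvd_of_pow_eq_one hxk)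
      (Nat.Coprime.pow_left _ ((Nat.Prime.coprime_iff_not_dvd hp).2 hyp)))
  exact congrArg Subtype.val h

/-- The centralizer of the set of elements of `F` of order prime to `p`. -/
def coprimeCentralizer (F : Subgroup G) (p : ℕ) : Subgroup G :=
  Subgroup.centralizer {y | y ∈ F ∧ ¬ p ∣ orderOf y}

theorem mem_coprimeCentralizer {F : Subgroup G} {x : G} :
    x ∈ coprimeCentralizer F p ↔ ∀ y ∈ F, ¬ p ∣ orderOf y → Commute x y :=
  ⟨fun h y hy hyp => (h y ⟨hy, hyp⟩).symm, fun h y hy => (h y hy.1 hy.2).symm.eq⟩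

instance coprimeCentralizer_normal (F : Subgroup G) [hF : F.Normal] (p : ℕ) :
    (coprimeCentralizer F p).Normal := by
  refine ⟨fun x hx g => ?_⟩
  rw [mem_coprimeCentralizer] at *
  intro y hy hyp
  have h1 := hx (g⁻¹ * y * g) (by simpa using hF.conj_mem y hy g⁻¹)
    (by simpa using not_dvd_orderOf_conj g⁻¹ hyp)
  calc g * x * g⁻¹ * y = g * (x * (g⁻¹ * y * g)) * g⁻¹ := by group
    _ = y * (g * x * g⁻¹) := by rw [h1.eq]; group

variable [Finite G]

theorem Group.IsNilpotent.not_dvd_orderOf_mul {U : Subgroup G} (hU : Group.IsNilpotent U)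
    (hp : p.Prime) {x y : G} (hx : x ∈ U) (hy : y ∈ U) (hxp : ¬ p ∣ orderOf x)
    (hyp : ¬ p ∣ orderOf y) : ¬ p ∣ orderOf (x * y) := by
  have := Group.IsNilpotent.isPNilpotent hp (X := U) ⟨x, hx⟩ ⟨y, hy⟩
  simp only [MulMemClass.mk_mul_mk, Subgroup.orderOf_mk] at this
  exact this hxp hyp

/-- The Sylow `p`-subgroup of a nilpotent subgroup, as the set of its `p`-elements. -/
def pPart (hp : p.Prime) (U : Subgroup G) (hU : Group.IsNilpotent U) : Subgroup G where
  carrier := {x | x ∈ U ∧ ∃ k : ℕ, x ^ p ^ k = 1}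
  one_mem' := ⟨one_mem U, 0, one_pow _⟩
  inv_mem' := by
    rintro x ⟨hx, k, hk⟩
    exact ⟨inv_mem hx, k, by rw [inv_pow, hk, inv_one]⟩
  mul_mem' := by
    rintro x y ⟨hx, hxp⟩ ⟨hy, hyp⟩
    refine ⟨mul_mem hx hy, ?_⟩
    rw [exists_pow_eq_one_iff_forall_prime hp] at *
    intro q hq hqp
    exact hU.not_dvd_orderOf_mul hq hx hy (hxp q hq hqp) (hyp q hq hqp)

theorem isPGroup_pPart (hp : p.Prime) {U : Subgroup G} (hU : Group.IsNilpotent U) :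
    IsPGroup p (pPart hp U hU) := by
  rintro ⟨x, hx, k, hk⟩
  exact ⟨k, Subtype.ext hk⟩

/-- `F` is generated by elements of prime power order, and each of these has order prime to `p` or
to `q`. -/
theorem coprimeCentralizer_inf_le_centralizer (F : Subgroup G) {q : ℕ} (hpq : p ≠ q)
    (hp : p.Prime) (hq : q.Prime) :
    coprimeCentralizer F p ⊓ coprimeCentralizer F q ≤ Subgroup.centralizer F := by
  rintro x ⟨hxp, hxq⟩
  replace hxp := mem_coprimeCentralizer.1 hxp
  replace hxq := mem_coprimeCentralizer.1 hxq
  have : F ≤ Subgroup.centralizer {x} := by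
    refine Subgroup.le_of_forall_prime_pow_mem fun r hr y hy k hk => ?_
    rw [Subgroup.mem_centralizer_singleton_iff]
    have hyr := (exists_pow_eq_one_iff_forall_prime hr y).1 ⟨k, hk⟩
    by_cases hrp : p = r
    · exact (hxq y hy (hyr q hq fun h => hpq (hrp.trans h.symm))).symm
    · exact (hxp y hy (hyr p hp hrp)).symm
  intro y hy
  exact Subgroup.mem_centralizer_singleton_iff.1 (this hy)

/-- Coprime action: a `p`-element of a subnormal subgroup `N` which centralizes the `p'`-elements
of `F ∩ N` centralizes those of `F`. -/
theorem mem_coprimeCentralizer_of_isSubnormal {F : Subgroup G} (hFn : F.Normal)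
    (hF : Group.IsNilpotent F) (hp : p.Prime) {N : Subgroup G} (hN : N.IsSubnormal) {x : G}
    (hx : x ∈ N) {k : ℕ} (hxk : x ^ p ^ k = 1)
    (hxF : ∀ y ∈ F ⊓ N, ¬ p ∣ orderOf y → Commute x y) : x ∈ coprimeCentralizer F p := by
  induction hN with
  | top => exact mem_coprimeCentralizer.2 fun y hy hyp => hxF y ⟨hy, trivial⟩ hyp
  | step N K hle _ hn ih =>
    refine ih (hle hx) fun a ha hap => ?_
    rw [Subgroup.normal_subgroupOf_iff hle] at hn
    have hxa : x * a * x⁻¹ ∈ F := hFn.conj_mem a ha.1 x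
    obtain ⟨c, hc⟩ : ∃ c, c = x * a * x⁻¹ * a⁻¹ := ⟨_, rfl⟩
    have hcF : c ∈ F := hc ▸ F.mul_mem hxa (F.inv_mem ha.1)
    have hcN : c ∈ N := by
      have := N.mul_mem hx (hn x⁻¹ a (N.inv_mem hx) ha.2)
      rwa [show x * (a * x⁻¹ * a⁻¹) = c by rw [hc]; group] at this
    have hcp : ¬ p ∣ orderOf c := by
      rw [hc]
      exact hF.not_dvd_orderOf_mul hp hxa (F.inv_mem ha.1) (not_dvd_orderOf_conj x hap)
        (by simpa using hap)
    have hxc : Commute x c := hxF c ⟨hcF, hcN⟩ hcp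
    -- Since `x` commutes with `c`, conjugation by `x ^ n` multiplies `a` by `c ^ n`. At `n = p ^ k`
    -- this gives `c ^ p ^ k = 1`, and `c` is a `p'`-element.
    have key : ∀ n : ℕ, x ^ n * a = c ^ n * a * x ^ n := by
      intro n
      induction n with
      | zero => simp
      | succ n ih =>
        calc x ^ (n + 1) * a = x * (x ^ n * a) := by rw [pow_succ']; group
          _ = x * c ^ n * a * x ^ n := by rw [ih]; group
          _ = c ^ n * (x * a * x⁻¹ * a⁻¹) * a * (x * x ^ n) := by
            rw [(hxc.pow_right n).eq]; group
          _ = c ^ (n + 1) * a * x ^ (n + 1) := by rw [← hc, ← pow_succ, ← pow_succ']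
    have h1 := key (p ^ k)
    rw [hxk, one_mul, mul_one] at h1
    have h2 : c = 1 := eq_one_of_pow_eq_one_of_not_dvd hp hcp (right_eq_mul.1 h1)
    rw [h2] at hc
    exact (mul_inv_eq_iff_eq_mul.1 (mul_inv_eq_one.1 hc.symm))

theorem pPart_le_coprimeCentralizer {F N U : Subgroup G} (hFn : F.Normal)
    (hF : Group.IsNilpotent F) (hp : p.Prime) (hN : N.IsSubnormal) (hU : Group.IsNilpotent U)
    (hUN : U ≤ N) (hFU : F ⊓ N ≤ U) : pPart hp U hU ≤ coprimeCentralizer F p := by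
  rintro x ⟨hx, k, hk⟩
  exact mem_coprimeCentralizer_of_isSubnormal hFn hF hp hN (hUN hx) hk fun y hy hyp =>
    hU.commute_of_mem hp hx (hFU hy) hk hyp

/-- The `p`-part of `F` is a `p`-subgroup of the centralizer invariant under conjugation, so lying
in one Sylow subgroup it lies in all. -/
theorem pPart_le_of_isSylowIn {F P : Subgroup G} (hFn : F.Normal) (hF : Group.IsNilpotent F)
    (hp : p.Prime) (hP : IsSylowIn p P (coprimeCentralizer F p)) : pPart hp F hF ≤ P := by
  have hle : pPart hp F hF ≤ coprimeCentralizer F p :=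
    pPart_le_coprimeCentralizer hFn hF hp .top hF le_top inf_le_left
  obtain ⟨Q, hQ, hFQ⟩ := (isPGroup_pPart hp hF).exists_isSylowIn_le hp hle
  obtain ⟨g, -, rfl⟩ := hQ.exists_conj hp hP
  rintro x ⟨hx, k, hk⟩
  refine ⟨g⁻¹ * x * g, hFQ ⟨by simpa using hFn.conj_mem x hx g⁻¹, k, ?_⟩, by simp [mul_assoc]⟩
  have := conj_pow (i := p ^ k) (a := g⁻¹) (b := x)
  rw [inv_inv] at this
  rw [this, hk]
  group

end NilpotentSubgroups

/-! ### Mann's theorem on nilpotent injectors of constrained groups. -/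

section Mann

variable {G : Type u} [Group G]

/-- A choice of a Sylow `p`-subgroup of the centralizer of the `p'`-part of `F` for every `p`. -/
def IsSylowFamily (F : Subgroup G) (P : Nat.Primes → Subgroup G) : Prop :=
  ∀ p : Nat.Primes, IsSylowIn p (P p) (coprimeCentralizer F p)

theorem IsSylowFamily.eq_bot_of_not_dvd {F : Subgroup G} {P : Nat.Primes → Subgroup G}
    (hP : IsSylowFamily F P) {p : Nat.Primes}
    (hp : ¬ (p : ℕ) ∣ Nat.card G) : P p = ⊥ := by
  have := Fact.mk p.2
  rcases (hP p).isPGroup.card_eq_or_dvd with h | h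
  · exact Subgroup.card_eq_one.1 h
  · exact absurd (h.trans (Subgroup.card_subgroup_dvd_card _)) hp

variable [Finite G]

/-- If `F ⊇ C_G(F)` is a normal nilpotent subgroup and `P` is a Sylow `p`-subgroup of the
centralizer of the `p'`-part of `F`, then `P` is normalized by the centralizer of the `q'`-part of
`F`, for every prime `q ≠ p`. -/
theorem IsSylowIn.conj_mem_of_mem_coprimeCentralizer {F P : Subgroup G} (hFn : F.Normal)
    (hF : Group.IsNilpotent F) (hCF : Subgroup.centralizer F ≤ F) {p q : ℕ} (hp : p.Prime)
    (hq : q.Prime) (hpq : p ≠ q) (hP : IsSylowIn p P (coprimeCentralizer F p)) {g x : G}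
    (hg : g ∈ coprimeCentralizer F q) (hx : x ∈ P) : g * x * g⁻¹ ∈ P := by
  have hxC := hP.le hx
  obtain ⟨c, hc⟩ : ∃ c, c = g * x * g⁻¹ * x⁻¹ := ⟨_, rfl⟩
  have hcF : c ∈ F := by
    refine hCF (coprimeCentralizer_inf_le_centralizer F hpq hp hq ⟨?_, ?_⟩)
    · rw [hc]
      exact (coprimeCentralizer F p).mul_mem
        ((coprimeCentralizer_normal F p).conj_mem x hxC g) ((coprimeCentralizer F p).inv_mem hxC)
    · have := mul_mem hg ((coprimeCentralizer_normal F q).conj_mem g⁻¹ (inv_mem hg) x)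
      rwa [show g * (x * g⁻¹ * x⁻¹) = c by rw [hc]; group] at this
  -- Split the commutator as `c = a * b`. Then `g * x * g⁻¹ = b * (a * x)` with `a * x ∈ P`
  -- commuting with `b`; as the left side is a `p`-element, the `p'`-element `b` is trivial.
  obtain ⟨a, haF, b, hbF, hab, ha, hb⟩ := exists_mul_eq_prime_part hp hcF
  have haP : a ∈ P := pPart_le_of_isSylowIn hFn hF hp hP ⟨haF, ha⟩
  obtain ⟨k, hk⟩ := ha
  have hab' : Commute a b := hF.commute_of_mem hp haF hbF hk hb
  have hax : a * x ∈ P := mul_mem haP hx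
  have hcomm : Commute (a * x) b := mem_coprimeCentralizer.1 (hP.le hax) b hbF hb
  have hgx : g * x * g⁻¹ = b * (a * x) := by
    rw [← mul_assoc, ← hab'.eq, ← hab, hc]
    group
  obtain ⟨m, hm⟩ := hP.isPGroup ⟨x, hx⟩
  obtain ⟨n, hn⟩ := hP.isPGroup ⟨a * x, hax⟩
  replace hm : x ^ p ^ m = 1 := congrArg Subtype.val hm
  replace hn : (a * x) ^ p ^ n = 1 := congrArg Subtype.val hn
  have h1 : (g * x * g⁻¹) ^ p ^ (m + n) = 1 := by
    rw [conj_pow, pow_add, pow_mul, hm, one_pow]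
    group
  have h2 : (a * x) ^ p ^ (m + n) = 1 := by
    rw [add_comm, pow_add, pow_mul, hn, one_pow]
  rw [hgx, hcomm.symm.mul_pow, h2, mul_one] at h1
  rw [hgx, eq_one_of_pow_eq_one_of_not_dvd hp hb h1, one_mul]
  exact hax

namespace IsSylowFamily

variable {F : Subgroup G} {P Q : Nat.Primes → Subgroup G}

theorem isNilpotent_iSup (hFn : F.Normal) (hF : Group.IsNilpotent F)
    (hCF : Subgroup.centralizer F ≤ F) (hP : IsSylowFamily F P) :
    Group.IsNilpotent (⨆ p, P p : Subgroup G) := by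
  have hnorm : ∀ p, IsNormalIn (P p) (⨆ p, P p) := by
    intro p
    refine ⟨le_iSup P p, ?_⟩
    rw [Subgroup.normal_subgroupOf_iff_le_normalizer (le_iSup P p)]
    refine iSup_le fun q => ?_
    by_cases hpq : p = q
    · rw [hpq]
      exact Subgroup.le_normalizer
    · have hconj : ∀ g ∈ P q, ∀ x ∈ P p, g * x * g⁻¹ ∈ P p := fun g hg x hx =>
        (hP p).conj_mem_of_mem_coprimeCentralizer hFn hF hCF p.2 q.2
          (fun h => hpq (Subtype.ext h)) ((hP q).le hg) hx
      intro g hg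
      rw [Subgroup.mem_normalizer_iff]
      refine fun x => ⟨hconj g hg x, fun hx => ?_⟩
      simpa [mul_assoc] using hconj g⁻¹ (inv_mem hg) _ hx
  have hle : (⨆ p, P p) ≤ setRadical (classTrace nilpotentClass G) (⨆ p, P p) := by
    refine iSup_le fun p => (hnorm p).le_setRadical ?_
    have := Fact.mk p.2
    exact (hP p).isPGroup.isNilpotent
  exact Subgroup.isNilpotent_of_le ((isFittingSet_nilpotent G).setRadical_mem _) hle

/-- The correcting element `c` for a new prime `p` comes from `coprimeCentralizer F p`, which
normalizes `Q q` for `q ≠ p`; so the primes already treated are undisturbed. -/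
theorem exists_conj_of_finset (hFn : F.Normal) (hF : Group.IsNilpotent F)
    (hCF : Subgroup.centralizer F ≤ F) (hP : IsSylowFamily F P) (hQ : IsSylowFamily F Q)
    (s : Finset Nat.Primes) :
    ∃ g : G, ∀ p ∈ s, Q p = (P p).map (MulAut.conj g).toMonoidHom := by
  classical
  induction s using Finset.induction_on with
  | empty => exact ⟨1, by simp⟩
  | insert p s hps ih =>
    obtain ⟨g, hg⟩ := ih
    obtain ⟨c, hc, hcQ⟩ := ((hP p).map_conj inferInstance g).exists_conj p.2 (hQ p)
    refine ⟨c * g, fun q hq => ?_⟩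
    have hmul : (P q).map (MulAut.conj (c * g)).toMonoidHom =
        ((P q).map (MulAut.conj g).toMonoidHom).map (MulAut.conj c).toMonoidHom := by
      rw [Subgroup.map_map]
      congr 1
      ext x
      simp
    rw [hmul]
    by_cases hqp : q = p
    · rw [hqp]
      exact hcQ
    · rw [← hg q (Finset.mem_of_mem_insert_of_ne hq hqp)]
      have hconj : ∀ d ∈ coprimeCentralizer F p, ∀ x ∈ Q q, d * x * d⁻¹ ∈ Q q := fun d hd x hx =>
        (hQ q).conj_mem_of_mem_coprimeCentralizer hFn hF hCF q.2 p.2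
          (fun h => hqp (Subtype.ext h)) hd hx
      ext x
      constructor
      · intro hx
        exact ⟨c⁻¹ * x * c, by simpa using hconj c⁻¹ (inv_mem hc) x hx, by simp [mul_assoc]⟩
      · rintro ⟨y, hy, rfl⟩
        exact hconj c hc y hy

theorem exists_conj (hFn : F.Normal) (hF : Group.IsNilpotent F)
    (hCF : Subgroup.centralizer F ≤ F) (hP : IsSylowFamily F P) (hQ : IsSylowFamily F Q) :
    AreConjugate (⨆ p, P p) (⨆ p, Q p) := by
  -- Only primes dividing `|G|` need conjugating: at the others both families are trivial.
  have hfin : {p : Nat.Primes | (p : ℕ) ∣ Nat.card G}.Finite := by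
    refine ((Nat.card G).primeFactors.finite_toSet.preimage
      Nat.Primes.coe_nat_injective.injOn).subset fun p hp => ?_
    exact Nat.mem_primeFactors.2 ⟨p.2, hp, Nat.card_pos.ne'⟩
  obtain ⟨g, hg⟩ := exists_conj_of_finset hFn hF hCF hP hQ hfin.toFinset
  refine ⟨g, ?_⟩
  rw [Subgroup.map_iSup]
  refine iSup_congr fun p => ?_
  by_cases hp : (p : ℕ) ∣ Nat.card G
  · exact hg p (by simpa using hp)
  · rw [hP.eq_bot_of_not_dvd hp, hQ.eq_bot_of_not_dvd hp, Subgroup.map_bot]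

end IsSylowFamily

/-- As `V ≥ F` is nilpotent, its `p`-part centralizes the `p'`-elements of `F` and extends to a
Sylow subgroup `P p`. The join of these is nilpotent and contains `V`, so maximality gives equality.
-/
theorem exists_isSylowFamily_of_isMaximalIn {F V : Subgroup G} (hFn : F.Normal)
    (hF : Group.IsNilpotent F) (hCF : Subgroup.centralizer F ≤ F)
    (hV : IsMaximalIn (classTrace nilpotentClass G) V ⊤) (hFV : F ≤ V) :
    ∃ P, IsSylowFamily F P ∧ V = ⨆ p, P p := by
  have hVn : Group.IsNilpotent V := hV.2.1
  choose P hP hVP using fun p : Nat.Primes =>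
    (isPGroup_pPart p.2 hVn).exists_isSylowIn_le p.2
      (pPart_le_coprimeCentralizer hFn hF p.2 .top hVn le_top (inf_le_left.trans hFV))
  refine ⟨P, hP, (hV.2.2 _ ?_ le_top (IsSylowFamily.isNilpotent_iSup hFn hF hCF hP)).symm⟩
  refine Subgroup.le_of_forall_prime_pow_mem fun p hp x hx k hk => ?_
  exact (le_iSup P ⟨p, hp⟩) (hVP ⟨p, hp⟩ ⟨hx, k, hk⟩)

namespace IsNConstrained

variable (hG : IsNConstrained G)

include hG

/-- In an `𝔑`-constrained group the maximal nilpotent subgroups containing the Fitting subgroup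
are conjugate. -/
theorem areConjugate_of_isMaximalIn {V W : Subgroup G}
    (hV : IsMaximalIn (classTrace nilpotentClass G) V ⊤) (hFV : fittingSubgroup G ≤ V)
    (hW : IsMaximalIn (classTrace nilpotentClass G) W ⊤) (hFW : fittingSubgroup G ≤ W) :
    AreConjugate V W := by
  have hF := isNilpotent_fittingSubgroup G
  have hFn := fittingSubgroup_normal G
  obtain ⟨P, hP, rfl⟩ := exists_isSylowFamily_of_isMaximalIn hFn hF hG hV hFV
  obtain ⟨Q, hQ, rfl⟩ := exists_isSylowFamily_of_isMaximalIn hFn hF hG hW hFW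
  exact IsSylowFamily.exists_conj hFn hF hG hP hQ

/-- In an `𝔑`-constrained group the maximal nilpotent subgroups containing the Fitting subgroup
are nilpotent injectors. -/
theorem isNilpotentInjector_of_isMaximalIn {V : Subgroup G}
    (hV : IsMaximalIn (classTrace nilpotentClass G) V ⊤) (hFV : fittingSubgroup G ≤ V) :
    IsNilpotentInjector V := by
  have hF := isNilpotent_fittingSubgroup G
  have hFn := fittingSubgroup_normal G
  have hVn : Group.IsNilpotent V := hV.2.1
  obtain ⟨P, hP, hVP⟩ := exists_isSylowFamily_of_isMaximalIn hFn hF hG hV hFV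
  refine fun N hN => ⟨inf_le_right, Subgroup.isNilpotent_of_le hVn inf_le_left,
    fun U hVU hUN hU => le_antisymm (le_inf ?_ hUN) hVU⟩
  refine Subgroup.le_of_forall_prime_pow_mem fun p hp x hx k hk => ?_
  have hPV : P ⟨p, hp⟩ ≤ V := hVP ▸ le_iSup P ⟨p, hp⟩
  have hle : pPart hp U hU ≤ coprimeCentralizer (fittingSubgroup G) p :=
    pPart_le_coprimeCentralizer hFn hF hp hN hU hUN ((inf_le_inf_right N hFV).trans hVU)
  -- The `p`-part of `U` contains `P p ⊓ N`, which is already Sylow in the intersection of the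
  -- centralizer with `N`.
  refine hPV ((hP ⟨p, hp⟩).le_of_isPGroup hp hN (isPGroup_pPart hp hU)
    (le_inf hle fun y hy => hUN hy.1) ?_ ⟨hx, k, hk⟩)
  intro y hy
  obtain ⟨n, hn⟩ := (hP ⟨p, hp⟩).isPGroup ⟨y, hy.1⟩
  exact ⟨hVU ⟨hPV hy.1, hy.2⟩, n, congrArg Subtype.val hn⟩

end IsNConstrained

end Mann

/-! ### Generalities on injectors and maximal subgroups. -/

section Injectors

variable {G : Type u} [Group G] {F : Set (Subgroup G)} {V : Subgroup G}

theorem IsInjector.isMaximalIn_top (hV : IsInjector F V) : IsMaximalIn F V ⊤ := by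
  simpa using hV ⊤ .top

theorem IsInjector.le_of_isSubnormal (hV : IsInjector F V) {N : Subgroup G} (hN : N.IsSubnormal)
    (hNF : N ∈ F) : N ≤ V := by
  have h := (hV N hN).2.2 N inf_le_right le_rfl hNF
  exact h.le.trans inf_le_left

theorem IsMaximalIn.exists_ge [Finite G] {A : Subgroup G} (hA : A ∈ F) :
    ∃ V, A ≤ V ∧ IsMaximalIn F V ⊤ := by
  obtain ⟨V, hAV, hV⟩ := (Set.toFinite F).exists_le_maximal hA
  exact ⟨V, hAV, le_top, hV.1, fun U hVU _ hU => le_antisymm (hV.2 hU hVU) hVU⟩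

end Injectors

/-! ### The Hartley set compared with nilpotency modulo `G_h`. -/

section HartleySet

variable {G : Type u} [Group G] {h : Nat.Primes → Set (Subgroup G)}

theorem groupRadical_le_hRadical (h : Nat.Primes → Set (Subgroup G)) (p : Nat.Primes) :
    groupRadical (h p) ≤ hRadical h :=
  le_iSup (fun p => groupRadical (h p)) p

/-- The preimage in `G` of the Fitting subgroup of `G / G_h`. -/
def hFitting (h : Nat.Primes → Set (Subgroup G)) : Subgroup G :=
  (fittingSubgroup (G ⧸ hRadical h)).comap (QuotientGroup.mk' (hRadical h))

instance hFitting_normal (h : Nat.Primes → Set (Subgroup G)) : (hFitting h).Normal :=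
  (fittingSubgroup_normal _).comap _

theorem hRadical_le_hFitting (h : Nat.Primes → Set (Subgroup G)) : hRadical h ≤ hFitting h := by
  intro x hx
  have : QuotientGroup.mk' (hRadical h) x = 1 := (QuotientGroup.eq_one_iff x).2 hx
  rw [hFitting, Subgroup.mem_comap, this]
  exact one_mem _

theorem map_hFitting (h : Nat.Primes → Set (Subgroup G)) :
    (hFitting h).map (QuotientGroup.mk' (hRadical h)) = fittingSubgroup (G ⧸ hRadical h) :=
  Subgroup.map_comap_eq_self_of_surjective (QuotientGroup.mk'_surjective _) _

variable [Finite G]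

/-- The elementwise form replaces iterated quotients: passing to another subgroup or quotient only
requires comparing radicals. -/
theorem mem_hartleySet_iff {U : Subgroup G} :
    U ∈ hartleySet h ↔ ∀ p : Nat.Primes, ∀ x ∈ U, ∀ y ∈ U, ¬ (p : ℕ) ∣ orderOf x →
      ¬ (p : ℕ) ∣ orderOf y → ∃ n : ℕ, ¬ (p : ℕ) ∣ n ∧ (x * y) ^ n ∈ setRadical (h p) U := by
  simp only [hartleySet, Set.mem_iInter, setProd, Set.mem_ofPred_eq]
  refine forall_congr' fun p => ?_
  have hp : Nat.Prime (p : ℕ) := p.2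
  rw [classProd_pPrimeClass_pClass_iff hp]
  let f := QuotientGroup.mk' ((setRadical (h p) U).subgroupOf U)
  have hf : ∀ z : U, ∀ n : ℕ, f z ^ n = 1 ↔ (z : G) ^ n ∈ setRadical (h p) U := by
    intro z n
    rw [← map_pow]
    exact QuotientGroup.eq_one_iff _
  constructor
  · intro hU x hx y hy hxp hyp
    have hf' : ∀ z : U, ¬ (p : ℕ) ∣ orderOf (z : G) → ¬ (p : ℕ) ∣ orderOf (f z) := by
      intro z hz hd
      rw [Subgroup.orderOf_coe] at hz
      exact hz (hd.trans (orderOf_map_dvd f z))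
    have hxy := hU (f ⟨x, hx⟩) (f ⟨y, hy⟩) (hf' _ hxp) (hf' _ hyp)
    refine ⟨_, hxy, (hf (⟨x, hx⟩ * ⟨y, hy⟩) _).1 ?_⟩
    rw [map_mul]
    exact pow_orderOf_eq_one _
  · intro hU
    refine isPNilpotent_of_surjective hp f (QuotientGroup.mk'_surjective _) fun x y hx hy => ?_
    rw [← Subgroup.orderOf_coe] at hx hy
    obtain ⟨n, hn, hxy⟩ := hU x x.2 y y.2 hx hy
    exact not_dvd_orderOf_of_pow_eq_one hn ((hf (x * y) n).2 hxy)

/-- The image of `U` is then a quotient of each `p`-nilpotent group `U / U_{h(p)}`. -/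
theorem isNilpotent_map_of_mem_hartleySet {U : Subgroup G} (hU : U ∈ hartleySet h)
    (hUR : ∀ p, setRadical (h p) U ≤ hRadical h) :
    Group.IsNilpotent (U.map (QuotientGroup.mk' (hRadical h))) := by
  rw [mem_hartleySet_iff] at hU
  refine Group.isNilpotent_of_forall_isPNilpotent fun p hp => ?_
  refine isPNilpotent_of_surjective hp ((QuotientGroup.mk' (hRadical h)).subgroupMap U)
    (MonoidHom.subgroupMap_surjective _ _) fun x y hx hy => ?_
  rw [← Subgroup.orderOf_coe] at hx hy
  obtain ⟨n, hn, hxy⟩ := hU ⟨p, hp⟩ x x.2 y y.2 hx hy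
  refine not_dvd_orderOf_of_pow_eq_one hn (Subtype.ext ?_)
  exact (QuotientGroup.eq_one_iff (((x : G) * y) ^ n)).2 (hUR _ hxy)

/-- If `h` is full, then `G_h / G_{h(p)}` is a `p'`-group. -/
theorem IsFull.exists_pow_mem_groupRadical (hh : IsHFunction h) (h_full : IsFull h)
    (p : Nat.Primes) {g : G} (hg : g ∈ hRadical h) :
    ∃ n : ℕ, ¬ (p : ℕ) ∣ n ∧ g ^ n ∈ groupRadical (h p) := by
  have hn := groupRadical_normal (h p)
  have hp : Nat.Prime (p : ℕ) := p.2
  let π := QuotientGroup.mk' (groupRadical (h p))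
  have hπ : ∀ z : G, ∀ n : ℕ, π z ^ n = 1 ↔ z ^ n ∈ groupRadical (h p) := by
    intro z n
    rw [← map_pow]
    exact QuotientGroup.eq_one_iff _
  have key : ¬ (p : ℕ) ∣ Nat.card ((hRadical h).map π) := by
    rw [hRadical, Subgroup.map_iSup, ← sSup_range]
    refine not_dvd_card_sSup_of_normal hp _ ?_
    rintro _ ⟨q, rfl⟩
    refine ⟨(groupRadical_normal (h q)).map π (QuotientGroup.mk'_surjective _),
      not_dvd_card_of_forall_orderOf hp ?_⟩
    rintro ⟨_, x, hx, rfl⟩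
    rw [← Subgroup.orderOf_coe]
    change ¬ (p : ℕ) ∣ orderOf (π x)
    by_cases hqp : q = p
    · subst hqp
      refine not_dvd_orderOf_of_pow_eq_one (n := 1) (by simpa using q.2.ne_one) ((hπ x 1).2 ?_)
      simpa using hx
    -- By fullness the `h(p)`-radical of `G_{h(q)}` has `p'`-index there, and it lies in `G_{h(p)}`
    -- because `G_{h(q)}` is normal.
    · have hq := h_full q p hqp ((hh q).setRadical_mem ⊤)
      refine not_dvd_orderOf_of_pow_eq_one hq ((hπ x _).2 ?_)
      have hsub := (groupRadical_normal (h q)).isSubnormal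
      refine (hh p).setRadical_le_groupRadical hsub ?_
      exact Subgroup.pow_index_mem ((setRadical (h p) (groupRadical (h q))).subgroupOf
        (groupRadical (h q))) ⟨x, hx⟩
  refine ⟨_, key, (hπ g _).1 ?_⟩
  have h1 : (⟨π g, g, hg, rfl⟩ : (hRadical h).map π) ^ Nat.card ((hRadical h).map π) = 1 :=
    pow_card_eq_one'
  exact congrArg Subtype.val h1

/-- A product of `p'`-elements has `p'`-order modulo `G_h`, and a further `p'`-power takes it from
`G_h` into `G_{h(p)} ≤ V_{h(p)}`. -/
theorem mem_hartleySet_of_isNilpotent_map (hh : IsHFunction h) (h_full : IsFull h)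
    {V : Subgroup G} (hV : hRadical h ≤ V)
    (hVn : Group.IsNilpotent (V.map (QuotientGroup.mk' (hRadical h)))) : V ∈ hartleySet h := by
  rw [mem_hartleySet_iff]
  intro p x hx y hy hxp hyp
  have hp : Nat.Prime (p : ℕ) := p.2
  let π := QuotientGroup.mk' (hRadical h)
  have h1 : ¬ (p : ℕ) ∣ orderOf (π x * π y) :=
    hVn.not_dvd_orderOf_mul hp ⟨x, hx, rfl⟩ ⟨y, hy, rfl⟩
      (fun hd => hxp (hd.trans (orderOf_map_dvd π x)))
      (fun hd => hyp (hd.trans (orderOf_map_dvd π y)))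
  have h2 : (x * y) ^ orderOf (π x * π y) ∈ hRadical h := by
    have := pow_orderOf_eq_one (π x * π y)
    rw [← map_mul, ← map_pow] at this
    exact (QuotientGroup.eq_one_iff _).1 this
  obtain ⟨n, hn, h3⟩ := h_full.exists_pow_mem_groupRadical hh p h2
  refine ⟨orderOf (π x * π y) * n, fun hd => (hp.dvd_mul.1 hd).elim h1 hn, ?_⟩
  rw [pow_mul]
  exact ((groupRadical_normal (h p)).isNormalIn
    ((groupRadical_le_hRadical h p).trans hV)).le_setRadical ((hh p).setRadical_mem ⊤) h3

theorem inf_mem_hartleySet_of_isSubnormal (hh : IsHFunction h) {V N : Subgroup G}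
    (hV : V ∈ hartleySet h) (hN : N.IsSubnormal) : V ⊓ N ∈ hartleySet h := by
  induction hN with
  | top => simpa using hV
  | step N K hle _ hn ih =>
    have hnorm : IsNormalIn (V ⊓ N) (V ⊓ K) := by
      rw [inf_comm V, inf_comm V]
      exact IsNormalIn.inf_right ⟨hle, hn⟩ V
    rw [mem_hartleySet_iff] at ih ⊢
    intro p x hx y hy hxp hyp
    obtain ⟨n, hn, hxy⟩ := ih p x (hnorm.1 hx) y (hnorm.1 hy) hxp hyp
    exact ⟨n, hn, (hh p).inf_setRadical_le hnorm ⟨pow_mem (mul_mem hx hy) n, hxy⟩⟩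

theorem hFitting_mem_hartleySet (hh : IsHFunction h) (h_full : IsFull h) :
    hFitting h ∈ hartleySet h :=
  mem_hartleySet_of_isNilpotent_map hh h_full (hRadical_le_hFitting h) (by
    rw [map_hFitting]
    exact isNilpotent_fittingSubgroup _)

theorem groupRadical_hartleySet (hh : IsHFunction h) (h_full : IsFull h) :
    groupRadical (hartleySet h) = hFitting h := by
  refine le_antisymm (sSup_le ?_) ((hFitting_normal h).isNormalIn le_top |>.le_setRadical
    (hFitting_mem_hartleySet hh h_full))
  rintro N ⟨hN, hNH⟩
  have hN' := isNormalIn_top_iff.1 hN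
  rw [hFitting, ← Subgroup.map_le_iff_le_comap]
  refine le_fittingSubgroup_of_isSubnormal (hN'.isSubnormal.quotient) ?_
  exact isNilpotent_map_of_mem_hartleySet hNH fun p =>
    ((hh p).setRadical_le_groupRadical hN'.isSubnormal).trans (groupRadical_le_hRadical h p)

/-- With `S = U_{h(p)}` and `X = F ∩ N`, both normal in `U`, `S ∩ X` is subnormal in `G` and belongs
to `h(p)`, so it lies in `G_h`. Hence `S` centralizes `X` modulo `G_h`; constraint, inherited by the
image of `N`, gives `S ≤ X`, so `S ≤ G_h`. -/
theorem isNilpotent_map_of_hFitting_inf_le (hh : IsHFunction h)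
    (h_constr : IsNConstrained (G ⧸ hRadical h)) {N U : Subgroup G} (hN : N.IsSubnormal)
    (hU : U ∈ hartleySet h) (hUN : U ≤ N) (hFU : hFitting h ⊓ N ≤ U) :
    Group.IsNilpotent (U.map (QuotientGroup.mk' (hRadical h))) := by
  refine isNilpotent_map_of_mem_hartleySet hU fun p => ?_
  set S := setRadical (h p) U with hS
  set X := hFitting h ⊓ N with hX
  set π := QuotientGroup.mk' (hRadical h) with hπ
  have hSU : IsNormalIn S U := setRadical_isNormalIn _ _
  have hXN : IsNormalIn X N := by
    simpa using ((hFitting_normal h).isNormalIn le_top).inf_right N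
  have hXU : IsNormalIn X U := hXN.mono hFU hUN
  have hSX : S ⊓ X ≤ hRadical h := by
    have h1 : IsNormalIn (S ⊓ X) X := by
      simpa [inf_eq_right.2 hFU] using hSU.inf_right X
    have h2 : IsNormalIn (S ⊓ X) S := by
      simpa [inf_eq_right.2 hSU.1, inf_comm X S] using hXU.inf_right S
    exact ((hh p).le_groupRadical_of_isSubnormal (h1.isSubnormal (hXN.isSubnormal hN))
      ((hh p).normal_mem _ ((hh p).setRadical_mem U) _ h2)).trans (groupRadical_le_hRadical h p)
  intro s hs
  have hsU := hSU.1 hs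
  refine hSX ⟨hs, ?_, hUN hsU⟩
  change π s ∈ fittingSubgroup (G ⧸ hRadical h)
  refine h_constr.centralizer_inf_le (hN.map (QuotientGroup.mk'_surjective _))
    ⟨?_, ⟨s, hUN hsU, rfl⟩⟩
  rintro _ ⟨hyF, y, hy, rfl⟩
  have hyX : y ∈ X := ⟨hyF, hy⟩
  have hc : s * y * s⁻¹ * y⁻¹ ∈ hRadical h := by
    refine hSX ⟨?_, ?_⟩
    · have := S.mul_mem hs ((isNormalIn_iff.1 hSU).2 s⁻¹ (S.inv_mem hs) y (hFU hyX))
      rwa [show s * (y * s⁻¹ * y⁻¹) = s * y * s⁻¹ * y⁻¹ by group] at this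
    · exact X.mul_mem ((isNormalIn_iff.1 hXU).2 y hyX s hsU) (X.inv_mem hyX)
  have h1 : π (s * y * s⁻¹ * y⁻¹) = 1 := (QuotientGroup.eq_one_iff _).2 hc
  simp only [map_mul, map_inv] at h1
  exact (mul_inv_eq_iff_eq_mul.1 (mul_inv_eq_one.1 h1)).symm

theorem isMaximalIn_map_of_isMaximalIn_hartleySet (hh : IsHFunction h) (h_full : IsFull h)
    (h_constr : IsNConstrained (G ⧸ hRadical h)) {V : Subgroup G}
    (hV : IsMaximalIn (hartleySet h) V ⊤) (hFV : hFitting h ≤ V) :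
    IsMaximalIn (classTrace nilpotentClass (G ⧸ hRadical h))
      (V.map (QuotientGroup.mk' (hRadical h))) ⊤ := by
  refine ⟨le_top, isNilpotent_map_of_hFitting_inf_le hh h_constr .top hV.2.1 le_top
    (inf_le_left.trans hFV), fun U hVU _ hU => ?_⟩
  have hsurj := QuotientGroup.mk'_surjective (hRadical h)
  rw [Subgroup.map_le_iff_le_comap] at hVU
  have hmap := Subgroup.map_comap_eq_self_of_surjective hsurj U
  have hmem : U.comap (QuotientGroup.mk' (hRadical h)) ∈ hartleySet h :=
    mem_hartleySet_of_isNilpotent_map hh h_full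
      (((hRadical_le_hFitting h).trans hFV).trans hVU) (by rw [hmap]; exact hU)
  rw [← hV.2.2 _ hVU le_top hmem, hmap]

/-- A member `U` of the Hartley set with `V ⊓ N ≤ U ≤ N` contains `hFitting h ⊓ N`, so its image is
nilpotent and the injector property modulo `G_h` applies to it. -/
theorem isInjector_hartleySet_of_isNilpotentInjector (hh : IsHFunction h) (h_full : IsFull h)
    (h_constr : IsNConstrained (G ⧸ hRadical h)) {V : Subgroup G} (hRV : hRadical h ≤ V)
    (hV : IsNilpotentInjector (V.map (QuotientGroup.mk' (hRadical h)))) :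
    IsInjector (hartleySet h) V := by
  set π := QuotientGroup.mk' (hRadical h) with hπ
  have hker : π.ker ≤ V := by rwa [hπ, QuotientGroup.ker_mk']
  have hcomap : (V.map π).comap π = V := Subgroup.comap_map_eq_self hker
  have hVH : V ∈ hartleySet h :=
    mem_hartleySet_of_isNilpotent_map hh h_full hRV hV.isMaximalIn_top.2.1
  have hFV : hFitting h ≤ V := by
    rw [← hcomap]
    exact Subgroup.comap_mono (hV.le_of_isSubnormal (fittingSubgroup_normal _).isSubnormal
      (isNilpotent_fittingSubgroup _))
  refine fun N hN => ⟨inf_le_right, inf_mem_hartleySet_of_isSubnormal hh hVH hN,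
    fun U hVU hUN hU => le_antisymm (le_inf ?_ hUN) hVU⟩
  have hUn := isNilpotent_map_of_hFitting_inf_le hh h_constr hN hU hUN
    ((inf_le_inf_right N hFV).trans hVU)
  have hle : V.map π ⊓ N.map π ≤ U.map π := by
    rintro _ ⟨hx, n, hn, rfl⟩
    have hnV : n ∈ V := by
      rw [← hcomap]
      exact hx
    exact ⟨n, hVU ⟨hnV, hn⟩, rfl⟩
  have heq := (hV (N.map π) (hN.map (QuotientGroup.mk'_surjective _))).2.2 _ hle
    (Subgroup.map_mono hUN) hUn
  rw [← hcomap, ← Subgroup.map_le_iff_le_comap, heq]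
  exact inf_le_left

end HartleySet

/-! ### The main theorem. -/

theorem theorem1p5 {G : Type u} [Group G] [Finite G]
    (h : Nat.Primes → Set (Subgroup G)) (hh : IsHFunction h)
    (h_int : IsIntegrated h) (h_full : IsFull h)
    (H : Set (Subgroup G)) (hH : H = hartleySet h)
    (h_constr : IsNConstrained (G ⧸ hRadical h)) :
    (∀ V : Subgroup G, IsInjector H V ↔
      hRadical h ≤ V ∧ IsNilpotentInjector (V.map (QuotientGroup.mk' (hRadical h)))) ∧
    ((∃ V : Subgroup G, IsInjector H V) ∧
      ∀ V W : Subgroup G, IsInjector H V → IsInjector H W → AreConjugate V W) ∧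
    (∀ V : Subgroup G, IsInjector H V ↔ IsMaximalIn H V ⊤ ∧ groupRadical H ≤ V) := by
  subst hH
  rw [groupRadical_hartleySet hh h_full]
  set π := QuotientGroup.mk' (hRadical h) with hπ
  have inj_max : ∀ V, IsInjector (hartleySet h) V →
      IsMaximalIn (hartleySet h) V ⊤ ∧ hFitting h ≤ V := fun V hV =>
    ⟨hV.isMaximalIn_top, hV.le_of_isSubnormal (hFitting_normal h).isSubnormal
      (hFitting_mem_hartleySet hh h_full)⟩
  have max_map : ∀ V, IsMaximalIn (hartleySet h) V ⊤ → hFitting h ≤ V →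
      IsMaximalIn (classTrace nilpotentClass (G ⧸ hRadical h)) (V.map π) ⊤ ∧
        fittingSubgroup (G ⧸ hRadical h) ≤ V.map π := fun V hV hFV =>
    ⟨isMaximalIn_map_of_isMaximalIn_hartleySet hh h_full h_constr hV hFV, by
      rw [← map_hFitting]
      exact Subgroup.map_mono hFV⟩
  have max_nil : ∀ V, IsMaximalIn (hartleySet h) V ⊤ → hFitting h ≤ V →
      hRadical h ≤ V ∧ IsNilpotentInjector (V.map π) := fun V hV hFV =>
    ⟨(hRadical_le_hFitting h).trans hFV, h_constr.isNilpotentInjector_of_isMaximalIn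
      (max_map V hV hFV).1 (max_map V hV hFV).2⟩
  have nil_inj : ∀ V, hRadical h ≤ V ∧ IsNilpotentInjector (V.map π) →
      IsInjector (hartleySet h) V := fun V hV =>
    isInjector_hartleySet_of_isNilpotentInjector hh h_full h_constr hV.1 hV.2
  -- The three descriptions of `V` are equivalent by the cycle `inj_max`, `max_nil`, `nil_inj`.
  refine ⟨fun V => ⟨fun hV => max_nil V (inj_max V hV).1 (inj_max V hV).2, nil_inj V⟩,
    ⟨?_, fun V W hV hW => ?_⟩,
    fun V => ⟨inj_max V, fun hV => nil_inj V (max_nil V hV.1 hV.2)⟩⟩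
  · obtain ⟨V, hFV, hV⟩ := IsMaximalIn.exists_ge (hFitting_mem_hartleySet hh h_full)
    exact ⟨V, nil_inj V (max_nil V hV hFV)⟩
  · obtain ⟨hVm, hFV⟩ := inj_max V hV
    obtain ⟨hWm, hFW⟩ := inj_max W hW
    obtain ⟨x, hx⟩ := h_constr.areConjugate_of_isMaximalIn (max_map V hVm hFV).1
      (max_map V hVm hFV).2 (max_map W hWm hFW).1 (max_map W hWm hFW).2
    obtain ⟨g, rfl⟩ := QuotientGroup.mk'_surjective (hRadical h) x
    refine ⟨g, ?_⟩
    have hcomap : ∀ U : Subgroup G, hFitting h ≤ U → (U.map π).comap π = U := fun U hU =>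
      Subgroup.comap_map_eq_self (by
        rw [hπ, QuotientGroup.ker_mk']
        exact (hRadical_le_hFitting h).trans hU)
    have hFg : hFitting h ≤ V.map (MulAut.conj g).toMonoidHom := by
      have h1 : (hFitting h).map (MulAut.conj g).toMonoidHom = hFitting h :=
        Subgroup.Normal.map_conj_eq _ g
      rw [← h1]
      exact Subgroup.map_mono hFV
    -- Both `W` and the conjugate of `V` contain `G_h`, so they agree once their images in the
    -- quotient do.
    rw [← hcomap W hFW, ← hcomap _ hFg, hx, Subgroup.map_map, Subgroup.map_map]
    congr 2
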